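/- **Setting.** There are $n$ items and $T$ periods. Item $i$ has a price ladder $p^i_0<p^i_1<\dots<p^i_{d_i}$, where $p^i_{d_i}$ is the regular price, and unit costs $c^i_t\le p^i_0$. A price plan is $\boldsymbol x=(x^i_t)$ with $x^i_t\in\{p^i_0,\dots,p^i_{d_i}\}$; the prices before period $1$ are known ladder prices. The demand is of mixture type, with memory $M$: $$d^i_t(\boldsymbol x)=f^{ii}_t(x^i_t)\,h^i_{t1}(x^i_{t-1})\cdots h^i_{tM}(x^i_{t-M})+\sum_{j\ne i}f^{ij}_t(x^j_t).$$ On the price ladders, $f^{ii}_t$ and $h^i_{tk}$ are non-negative, every $h^i_{tk}$ is non-decreasing (post-promotion dip), and the self profit $y\mapsto(y-c^i_t)f^{ii}_t(y)$ is non-decreasing. Items $i\neq j$ are substitutable (complementary) if $f^{ij}_t$ and $f^{ji}_t$ are non-decreasing (non-increasing) on the ladders for all $t$; every pair of distinct items is one or the other. $S_i$ and $C_i$ denote the sets of items substitutable, respectively complementary, to $i$. **Problem (PPO).** Maximize $\sum_{i,t}(x^i_t-c^i_t)\,d^i_t(\boldsymbol x)$ over price plans that satisfy the business rules, where $\delta^i_t=1$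 if $x^i_t<p^i_{d_i}$ and $\delta^i_t=0$ otherwise: $\sum_t\delta^i_t\le L^i$ for all $i$; $\sum_i\delta^i_t\le K_t$ for all $t$; $\delta^i_t=\delta^j_t$ for all $t$ and $i,j\in G_t$; $\sum_{t=k}^{k+\tau_i}\delta^i_t\le1$ for all $i$ and $1\le k\le T-\tau_i$. Here $L^i,K_t,\tau_i\in\mathbb N$ and $G_t\subseteq\{1,\dots,n\}$ are given. The business rules may also be absent. **Formulation.** Let $\Delta^d=\{z\in\mathbb R^d:1\ge z_1\ge\dots\ge z_d\ge0\}$, with vertices $v_j=(1,\dots,1,0,\dots,0)$ ($j$ ones), $0\le j\le d$. A function $g$ on the ladder of item $i$ is lifted to the affine function $g(p^i_0)+\sum_j(g(p^i_j)-g(p^i_{j-1}))z_j$ on $\mathbb R^{d_i}$. Let $r^i_t,\ell^i_t,\xi^{ij}_t,\zeta^i_{tk}$ be the lifts of $y-c^i_t$, $(y-c^i_t)f^{ii}_t(y)$, $f^{ij}_t$, $h^i_{tk}$. For a function $h$ on the vertices of $\Delta^{e_1}\times\dots\times\Delta^{e_m}$ let $\psi(\boldsymbol j)=h(v_{j_1},\dots,v_{j_m})$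 and $$\operatorname{stair}(h)(\boldsymbol z)=\min_\pi\Bigl\{\psi(\boldsymbol j^0_\pi)+\sum_{s}\bigl(\psi(\boldsymbol j^s_\pi)-\psi(\boldsymbol j^{s-1}_\pi)\bigr)z_{\pi_s}\Bigr\},$$ over all staircases $\pi$, that is, monotone lattice paths $\boldsymbol j^0_\pi=\boldsymbol 0,\boldsymbol j^1_\pi,\dots,\boldsymbol j_\pi^N=(e_1,\dots,e_m)$ by unit steps, $N=\sum_a e_a$; $z_{\pi_s}$ is the $b$-th coordinate of block $a$ if step $s$ is the $b$-th step in direction $a$. For $m=2$, $\operatorname{rvs-stair}(h)$ is defined in the same way, with $\psi(j_1,j_2)$ replaced by $\psi(j_1,e_2-j_2)$ and $(\boldsymbol z_1,\boldsymbol z_2)$ replaced by $(\boldsymbol z_1,\boldsymbol z_2')$, where $z'_{2j}=1-z_{2,e_2+1-j}$. The formulation in the variables $(\boldsymbol x,\boldsymbol z,\boldsymbol\mu,\boldsymbol\nu)$ is $$\begin{aligned}\max\ &\sum_{i,t}\Bigl(\mu^i_t+\sum_{j\ne i}\nu^{ij}_t\Bigr)\\ \text{s.t. }&\mu^i_t\le\operatorname{stair}(\ell^i_t\,\zeta^i_{t1}\cdots\zeta^i_{tM})(\boldsymbol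 z^i_t,\boldsymbol z^i_{t-1},\dots,\boldsymbol z^i_{t-M}),\\&\nu^{ij}_t\le\operatorname{stair}(r^i_t\,\xi^{ij}_t)(\boldsymbol z^i_t,\boldsymbol z^j_t)\ (j\in S_i),\qquad \nu^{ij}_t\le\operatorname{rvs-stair}(r^i_t\,\xi^{ij}_t)(\boldsymbol z^i_t,\boldsymbol z^j_t)\ (j\in C_i),\\&x^i_t=p^i_0+\sum_j(p^i_j-p^i_{j-1})z^i_{tj},\quad \boldsymbol z^i_t\in\Delta^{d_i}\cap\{0,1\}^{d_i},\end{aligned}$$ together with the business rules $\sum_tz^i_{td_i}\ge T-L^i$; $\sum_iz^i_{td_i}\ge n-K_t$; $z^i_{td_i}=z^j_{td_j}$ for $i,j\in G_t$; $\sum_{t=k}^{k+\tau_i}z^i_{td_i}\ge\tau_i$ for $1\le k\le T-\tau_i$ (omitted when business rules are absent). For $t\le 0$, $\boldsymbol z^i_t$ is the vertex of the known price. **Claim.** (a) The formulation is an exact MIP formulation of (PPO): its LP relaxation (binary requirement dropped) is a polyhedron and its objective is linear; the projection of its feasible set on $\boldsymbol x$ is the feasible set of (PPO); for every feasible $\boldsymbol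 x$ the largest objective value over the feasible points above $\boldsymbol x$ is the profit of $\boldsymbol x$; hence both problems attain the same optimal value. (b) If all pairs of distinct items are substitutable and the business rules are absent, the LP relaxation solves (PPO): its feasible region is the convex hull of the feasible region of the MIP, its optimal value is attained and equals that of (PPO), it has an optimal solution at an extreme point, and for every optimal extreme point the component $\boldsymbol x$ is an optimal price plan of (PPO). -/

import Mathlib

open scoped BigOperators

noncomputable section

namespace PromoPlan

/-! ## Unary binarization -/

/-- The unary simplex `1 ≥ z_1 ≥ z_2 ≥ ... ≥ z_d ≥ 0`; the coordinate `z_j` is `z (j - 1)`. -/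
def unarySimplex (d : ℕ) : Set (Fin d → ℝ) :=
  {z | (∀ j, 0 ≤ z j ∧ z j ≤ 1) ∧ Antitone z}

/-- The coordinates `z_0, z_1, ..., z_{d+1}` with the conventions `z_0 = 1`, `z_{d+1} = 0`. -/
def coord {d : ℕ} (z : Fin d → ℝ) (j : ℕ) : ℝ :=
  if j = 0 then 1 else if h : j - 1 < d then z ⟨j - 1, h⟩ else 0

/-- The vertex `v_j` of the unary simplex: `j` ones followed by zeros. -/
def vertex (d : ℕ) (j : Fin (d + 1)) : Fin d → ℝ :=
  fun k => if k.val < j.val then 1 else 0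

/-- The affine lifting of a function given by its values `g 0, ..., g d` on a price ladder:
`g 0 + ∑_{j = 1}^{d} (g j - g (j - 1)) z_j`. -/
def affineLift {d : ℕ} (g : Fin (d + 1) → ℝ) (z : Fin d → ℝ) : ℝ :=
  g 0 + ∑ j : Fin d, (g j.succ - g j.castSucc) * z j

/-- The map `T`, with `λ_j = z_j - z_{j+1}` for `j = 0, ..., d`. -/
def toLambda {d : ℕ} (z : Fin d → ℝ) : Fin (d + 1) → ℝ :=
  fun j => coord z j.val - coord z (j.val + 1)

/-- The inverse of `T`, with `z_j = ∑_{k = j}^{d} λ_k` for `j = 1, ..., d`. -/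
def ofLambda {d : ℕ} (l : Fin (d + 1) → ℝ) : Fin d → ℝ :=
  fun j => ∑ k : Fin (d + 1), if j.val + 1 ≤ k.val then l k else 0

/-- The affine map `L^σ = T⁻¹ ∘ P^σ ∘ T`, where `P^σ` is the permutation matrix whose
`(j, k)` entry is `1` exactly when `j = σ k`.  It sends `v_j` to `v_{σ j}`. -/
def switchMap {d : ℕ} (σ : Equiv.Perm (Fin (d + 1))) (z : Fin d → ℝ) : Fin d → ℝ :=
  ofLambda (fun j => toLambda z (σ.symm j))

/-! ## Staircases and the staircase functions -/

section Stair

variable {ι : Type} [Fintype ι] [DecidableEq ι]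

/-- Staircases from `(0, ..., 0)` to `(d_i)_i`, given by the directions of their
`N = ∑ i, d i` moves: direction `i` is taken exactly `d i` times. -/
abbrev Staircase (d : ι → ℕ) : Type :=
  {π : Fin (∑ i, d i) → ι // ∀ i, (Finset.univ.filter (fun s => π s = i)).card = d i}

instance staircaseNonempty (d : ι → ℕ) : Nonempty (Staircase d) := by
  have hc : Fintype.card (Fin (∑ i, d i)) = Fintype.card (Σ i, Fin (d i)) := by simp
  let e := Fintype.equivOfCardEq hc
  refine ⟨⟨fun s => (e s).1, fun i => ?_⟩⟩
  rw [← Fintype.card_subtype]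
  have e2 : {s // (e s).1 = i} ≃ {y : Σ i, Fin (d i) // y.1 = i} :=
    e.subtypeEquiv (fun _ => Iff.rfl)
  rw [Fintype.card_congr e2, Fintype.card_congr (Equiv.sigmaSubtype i)]
  simp

/-- The grid point reached by the staircase after its first `t` moves. -/
def Staircase.gridPt {d : ι → ℕ} (π : Staircase d) (t : ℕ) : ∀ i, Fin (d i + 1) :=
  fun i => ⟨(Finset.univ.filter (fun s => s.val < t ∧ π.1 s = i)).card,
    Nat.lt_succ_of_le ((Finset.card_le_card (fun s hs => by
      simp only [Finset.mem_filter] at hs ⊢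
      exact ⟨hs.1, hs.2.2⟩)).trans_eq (π.2 i))⟩

/-- The affine function of `z` attached to the staircase `π` and the grid function `ψ`,
`ψ(j^0) + ∑_t (ψ(j^t) - ψ(j^{t-1})) z_{π_t}`.  Move number `t + 1` goes in direction `π.1 t` and is
the `π.gridPt (t + 1) (π.1 t)`-th move in that direction. -/
def stairAffine {d : ι → ℕ} (ψ : (∀ i, Fin (d i + 1)) → ℝ) (π : Staircase d)
    (z : ∀ i, Fin (d i) → ℝ) : ℝ :=
  ψ (π.gridPt 0) + ∑ t : Fin (∑ i, d i),
    (ψ (π.gridPt (t.val + 1)) - ψ (π.gridPt t.val)) *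
      coord (z (π.1 t)) (π.gridPt (t.val + 1) (π.1 t)).val

/-- The minimum of the staircase functions over all staircases. -/
def stairMin {d : ι → ℕ} (ψ : (∀ i, Fin (d i + 1)) → ℝ) (z : ∀ i, Fin (d i) → ℝ) : ℝ :=
  Finset.univ.inf' Finset.univ_nonempty (fun π : Staircase d => stairAffine ψ π z)

/-- `stair(h)`, for a function `h` on the vertices of the simplotope. -/
def stair {d : ι → ℕ} (h : (∀ i, Fin (d i) → ℝ) → ℝ) (z : ∀ i, Fin (d i) → ℝ) : ℝ :=
  stairMin (fun j => h (fun i => vertex (d i) (j i))) z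

/-- The staircase function of `h` after switching by the permutations `σ`: the grid function is
`j ↦ h(v_{σ(j)})` and the argument is `z' = (L^σ)⁻¹(z)`, where `(L^σ)⁻¹ = L^{σ⁻¹}`. -/
def switchedStair {d : ι → ℕ} (σ : ∀ i, Equiv.Perm (Fin (d i + 1)))
    (h : (∀ i, Fin (d i) → ℝ) → ℝ) (z : ∀ i, Fin (d i) → ℝ) : ℝ :=
  stairMin (fun j => h (fun i => vertex (d i) (σ i (j i))))
    (fun i => switchMap (σ i).symm (z i))

end Stair

/-- `rvs-stair(h)`: two factors; the first ladder keeps its order, the second is reversed. -/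
def rvsStair {d : Fin 2 → ℕ} (h : (∀ a, Fin (d a) → ℝ) → ℝ) (z : ∀ a, Fin (d a) → ℝ) : ℝ :=
  switchedStair (fun a => if a = 0 then Equiv.refl _ else Fin.revPerm) h z

/-! ## The price promotion problem with mixture demand -/

/-- The data: `n` items, `T` periods (`t : Fin T` is period `t + 1`), memory of `M` periods. -/
structure Data (n T M : ℕ) where
  /-- number of promotion levels of each item -/
  d : Fin n → ℕ
  /-- price ladders; the last price is the regular one -/
  p : ∀ i, Fin (d i + 1) → ℝ
  /-- unit costs `c^i_t` -/
  c : Fin n → Fin T → ℝ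
  /-- `f i j t`: effect of the price of item `j` in period `t` on the demand of item `i` -/
  f : Fin n → Fin n → Fin T → ℝ → ℝ
  /-- `h i t k`: effect on the demand of item `i` in period `t` of its price `k + 1` periods ago -/
  h : Fin n → Fin T → Fin M → ℝ → ℝ
  /-- known ladder level of item `i` in period `-s` (that is, `s + 1` periods before period 1) -/
  hist : ∀ i, ℕ → Fin (d i + 1)

variable {n T M : ℕ}

/-- A price plan. -/
abbrev Plan (n T : ℕ) : Type := Fin n → Fin T → ℝ

/-- The price ladder of item `i`. -/
def Data.ladder (D : Data n T M) (i : Fin n) : Set ℝ := Set.range (D.p i)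

/-- The price of item `i`, `k` periods before `t`. -/
def Data.lagPrice (D : Data n T M) (x : Plan n T) (i : Fin n) (t : Fin T) (k : ℕ) : ℝ :=
  if k ≤ t.val then x i ⟨t.val - k, (Nat.sub_le _ _).trans_lt t.isLt⟩
  else D.p i (D.hist i (k - t.val - 1))

/-- The mixture demand: cross-period effects are multiplicative, cross-item effects additive. -/
def Data.demand (D : Data n T M) (x : Plan n T) (i : Fin n) (t : Fin T) : ℝ :=
  D.f i i t (x i t) * ∏ k : Fin M, D.h i t k (D.lagPrice x i t (k.val + 1))
    + ∑ j : {j : Fin n // j ≠ i}, D.f i j t (x j t)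

/-- The total profit of a price plan. -/
def Data.profit (D : Data n T M) (x : Plan n T) : ℝ :=
  ∑ i, ∑ t, (x i t - D.c i t) * D.demand x i t

/-- Parameters of the business rules. -/
structure BusinessRules (n T : ℕ) where
  /-- maximal number of promotions of an item -/
  L : Fin n → ℕ
  /-- maximal number of promotions in a period -/
  C : Fin T → ℕ
  /-- items that are promoted together in a period -/
  S : Fin T → Set (Fin n)
  /-- number of periods that separate promotions of an item -/
  τ : Fin n → ℕ

/-- `1` if item `i` is on promotion in period `t`, else `0`. -/
def Data.promo (D : Data n T M) (x : Plan n T) (i : Fin n) (t : Fin T) : ℕ :=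
  if x i t < D.p i (Fin.last (D.d i)) then 1 else 0

/-- The business rules, for prices. -/
def Data.PriceRules (D : Data n T M) (B : BusinessRules n T) (x : Plan n T) : Prop :=
  (∀ i, ∑ t, D.promo x i t ≤ B.L i) ∧
  (∀ t, ∑ i, D.promo x i t ≤ B.C t) ∧
  (∀ t, ∀ i ∈ B.S t, ∀ j ∈ B.S t, D.promo x i t = D.promo x j t) ∧
  (∀ i, ∀ k : ℕ, k + B.τ i < T →
    ∑ t ∈ Finset.univ.filter (fun t : Fin T => k ≤ t.val ∧ t.val ≤ k + B.τ i),
      D.promo x i t ≤ 1)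

/-- The feasible price plans; `none` means that there are no business rules. -/
def Data.feasible (D : Data n T M) (R : Option (BusinessRules n T)) : Set (Plan n T) :=
  {x | (∀ i t, x i t ∈ D.ladder i) ∧ ∀ B ∈ R, D.PriceRules B x}

/-- Items `i` and `j` are substitutable: `f^{ij}_t` and `f^{ji}_t` are increasing for all `t`. -/
def Data.Substitutable (D : Data n T M) (i j : Fin n) : Prop :=
  ∀ t, MonotoneOn (D.f i j t) (D.ladder j) ∧ MonotoneOn (D.f j i t) (D.ladder i)

/-- Items `i` and `j` are complementary: `f^{ij}_t` and `f^{ji}_t` are decreasing for all `t`. -/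
def Data.Complementary (D : Data n T M) (i j : Fin n) : Prop :=
  ∀ t, AntitoneOn (D.f i j t) (D.ladder j) ∧ AntitoneOn (D.f j i t) (D.ladder i)

/-! ## The formulation -/

/-- The binarization variables `z^i_{t,j}`. -/
abbrev Data.ZVar (D : Data n T M) : Type := ∀ i : Fin n, Fin T → Fin (D.d i) → ℝ

/-- All variables `(x, z, μ, ν)` of the formulation. -/
abbrev Data.Var (D : Data n T M) : Type :=
  Plan n T × D.ZVar × (Fin n → Fin T → ℝ) × (∀ i : Fin n, {j : Fin n // j ≠ i} → Fin T → ℝ)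

/-- The block `z^i_{t-k}`; before the first period it is the vertex of the known level. -/
def Data.lagZ (D : Data n T M) (z : D.ZVar) (i : Fin n) (t : Fin T) (k : ℕ) : Fin (D.d i) → ℝ :=
  if k ≤ t.val then z i ⟨t.val - k, (Nat.sub_le _ _).trans_lt t.isLt⟩
  else vertex (D.d i) (D.hist i (k - t.val - 1))

/-- The lifted representation of the function `φ` of the price of item `i`. -/
def Data.liftFn (D : Data n T M) (i : Fin n) (φ : ℝ → ℝ) (z : Fin (D.d i) → ℝ) : ℝ :=
  affineLift (fun j => φ (D.p i j)) z

/-- The product `ℓ^i_t · ζ^i_{t1} ⋯ ζ^i_{tM}`: block `0` carries the current price, block `k` the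
price `k` periods ago. -/
def Data.periodTerm (D : Data n T M) (i : Fin n) (t : Fin T)
    (w : Fin (M + 1) → Fin (D.d i) → ℝ) : ℝ :=
  D.liftFn i (fun y => (y - D.c i t) * D.f i i t y) (w 0)
    * ∏ k : Fin M, D.liftFn i (D.h i t k) (w k.succ)

/-- The product `r^i_t · ξ^{ij}_t`. -/
def Data.itemTerm (D : Data n T M) (i j : Fin n) (t : Fin T)
    (w : ∀ a : Fin 2, Fin (D.d (![i, j] a)) → ℝ) : ℝ :=
  D.liftFn i (fun y => y - D.c i t) (w 0) * D.liftFn j (D.f i j t) (w 1)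

/-- The business rules in terms of `z`; `z^i_{t,d_i} = 1` means that there is no promotion. -/
def Data.ZRules (D : Data n T M) (B : BusinessRules n T) (z : D.ZVar) : Prop :=
  (∀ i, (T : ℝ) - B.L i ≤ ∑ t, coord (z i t) (D.d i)) ∧
  (∀ t, (n : ℝ) - B.C t ≤ ∑ i, coord (z i t) (D.d i)) ∧
  (∀ t, ∀ i ∈ B.S t, ∀ j ∈ B.S t, coord (z i t) (D.d i) = coord (z j t) (D.d j)) ∧
  (∀ i, ∀ k : ℕ, k + B.τ i < T →
    (B.τ i : ℝ) ≤ ∑ t ∈ Finset.univ.filter (fun t : Fin T => k ≤ t.val ∧ t.val ≤ k + B.τ i),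
      coord (z i t) (D.d i))

/-- The feasible region of the LP relaxation of the stair / reverse-stair formulation. -/
def Data.lpRegion (D : Data n T M) (R : Option (BusinessRules n T)) : Set D.Var :=
  {y | match y with
    | (x, z, μ, ν) =>
      (∀ i t, x i t = D.liftFn i id (z i t) ∧ z i t ∈ unarySimplex (D.d i)) ∧
      (∀ B ∈ R, D.ZRules B z) ∧
      (∀ i t, μ i t ≤ stair (d := fun _ : Fin (M + 1) => D.d i) (D.periodTerm i t)
        (fun a => D.lagZ z i t a.val)) ∧
      (∀ i t, ∀ j : {j : Fin n // j ≠ i}, D.Substitutable i j →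
        ν i j t ≤ stair (d := fun a => D.d (![i, j.1] a)) (D.itemTerm i j t)
          (fun a => z (![i, j.1] a) t)) ∧
      (∀ i t, ∀ j : {j : Fin n // j ≠ i}, D.Complementary i j →
        ν i j t ≤ rvsStair (d := fun a => D.d (![i, j.1] a)) (D.itemTerm i j t)
          (fun a => z (![i, j.1] a) t))}

/-- The feasible region of the MIP formulation: all `z` variables are binary. -/
def Data.mipRegion (D : Data n T M) (R : Option (BusinessRules n T)) : Set D.Var :=
  {y | y ∈ D.lpRegion R ∧ ∀ i t j, y.2.1 i t j = 0 ∨ y.2.1 i t j = 1}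

/-- The objective function of the formulation. -/
def Data.objective (D : Data n T M) (y : D.Var) : ℝ :=
  ∑ i, ∑ t, (y.2.2.1 i t + ∑ j : {j : Fin n // j ≠ i}, y.2.2.2 i j t)

/-- A polyhedron: the solution set of finitely many linear inequalities. -/
def IsPolyhedron {E : Type} [AddCommGroup E] [Module ℝ E] (Q : Set E) : Prop :=
  ∃ (m : ℕ) (a : Fin m → E →ₗ[ℝ] ℝ) (b : Fin m → ℝ), Q = {y | ∀ k, a k y ≤ b k}

end PromoPlan

end

namespace PromoPlan

/-! Both parts rest on supermodularity. For supermodular `ψ` on a product of chains, the affine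
function of a staircase agrees with `ψ` at the grid points on the staircase
(`stairAffine_vertex_gridPt`) and lies above `ψ` at all others (`le_stairAffine_vertex`). Every grid
point lies on some staircase, so the minimum over staircases takes the value of `ψ` at each vertex
(`stairMin_vertex`).

The profit terms are of this kind. The term of one item across periods is a product of non-negative
non-decreasing functions of single coordinates. A cross-item term is a product of two functions of
different coordinates, both non-decreasing for substitutes; for complements the second one is
non-increasing, and reversing its ladder repairs this. Hence over a binary `z` the largest
admissible `μ` and `ν` are exactly the profit contributions (`Data.mem_mipRegion_iff`), which gives
(a); the relaxation is polyhedral since each bound is a minimum of finitely many affine functions.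

For (b), cut a fractional `z` at thresholds `s` in `(0, 1]`: in every block, `z` is the same
weighted average of the vertices given by its levels. These levels decrease as `s` grows,
simultaneously in all blocks, so for any choice of blocks they lie on one staircase, and the affine
function of that staircase bounds `stair` by the average of the vertex values
(`stairMin_le_sum_levels`). One decomposition therefore serves all constraints at once, and the
relaxation is the convex hull of the MIP region (`Data.lpRegion_eq_convexHull`). A linear objective
has the same maximum on both, and the extreme points of the hull are MIP points. -/

/-! ## Affine functions and polyhedra -/

/-- A real function that is a linear functional plus a constant. -/
def IsAffineFn {E : Type} [AddCommGroup E] [Module ℝ E] (f : E → ℝ) : Prop :=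
  ∃ (a : E →ₗ[ℝ] ℝ) (b : ℝ), ∀ y, f y = a y + b

section Affine

variable {E : Type} [AddCommGroup E] [Module ℝ E]

theorem IsAffineFn.const (b : ℝ) : IsAffineFn (fun _ : E => b) := ⟨0, b, by simp⟩

theorem IsAffineFn.linear (a : E →ₗ[ℝ] ℝ) : IsAffineFn (fun y => a y) := ⟨a, 0, by simp⟩

theorem IsAffineFn.add {f g : E → ℝ} (hf : IsAffineFn f) (hg : IsAffineFn g) :
    IsAffineFn (fun y => f y + g y) := by
  obtain ⟨a, b, h⟩ := hf
  obtain ⟨a', b', h'⟩ := hg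
  exact ⟨a + a', b + b', fun y => by simp only [h, h', LinearMap.add_apply]; ring⟩

theorem IsAffineFn.const_mul {f : E → ℝ} (hf : IsAffineFn f) (r : ℝ) :
    IsAffineFn (fun y => r * f y) := by
  obtain ⟨a, b, h⟩ := hf
  exact ⟨r • a, r * b, fun y => by simp only [h, LinearMap.smul_apply, smul_eq_mul]; ring⟩

theorem IsAffineFn.sub {f g : E → ℝ} (hf : IsAffineFn f) (hg : IsAffineFn g) :
    IsAffineFn (fun y => f y - g y) := by
  have := hf.add (hg.const_mul (-1))
  convert this using 2
  ring

theorem IsAffineFn.sum {κ : Type*} (s : Finset κ) {f : κ → E → ℝ}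
    (hf : ∀ k ∈ s, IsAffineFn (f k)) : IsAffineFn (fun y => ∑ k ∈ s, f k y) := by
  classical
  induction s using Finset.induction_on with
  | empty => simpa using IsAffineFn.const (E := E) 0
  | insert k s hk ih =>
    simp only [Finset.sum_insert hk]
    exact (hf k (Finset.mem_insert_self _ _)).add
      (ih fun l hl => hf l (Finset.mem_insert_of_mem hl))

theorem IsAffineFn.ite {f g : E → ℝ} (P : Prop) [Decidable P] (hf : P → IsAffineFn f)
    (hg : ¬ P → IsAffineFn g) : IsAffineFn (fun y => if P then f y else g y) := by
  by_cases h : P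
  · simpa [h] using hf h
  · simpa [h] using hg h

/-- Total weight one is what preserves the constant term; the signs of the weights play no role. -/
theorem IsAffineFn.map_sum {f : E → ℝ} (hf : IsAffineFn f) {κ : Type*} (s : Finset κ)
    (w : κ → ℝ) (hw : ∑ k ∈ s, w k = 1) (v : κ → E) :
    f (∑ k ∈ s, w k • v k) = ∑ k ∈ s, w k * f (v k) := by
  obtain ⟨a, b, h⟩ := hf
  simp only [h, _root_.map_sum, map_smul, smul_eq_mul, mul_add, Finset.sum_add_distrib,
    ← Finset.sum_mul, hw, one_mul]

theorem isPolyhedron_univ : IsPolyhedron (Set.univ : Set E) :=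
  ⟨0, fun k => k.elim0, fun k => k.elim0, by ext; simp⟩

theorem IsPolyhedron.and {P Q : E → Prop} (hP : IsPolyhedron {y | P y})
    (hQ : IsPolyhedron {y | Q y}) : IsPolyhedron {y | P y ∧ Q y} := by
  obtain ⟨m, a, b, h⟩ := hP
  obtain ⟨m', a', b', h'⟩ := hQ
  refine ⟨m + m', Fin.append a a', Fin.append b b', ?_⟩
  ext y
  have h1 : P y ↔ ∀ k, a k y ≤ b k := by
    simpa using Set.ext_iff.1 h y
  have h2 : Q y ↔ ∀ k, a' k y ≤ b' k := by
    simpa using Set.ext_iff.1 h' y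
  simp [h1, h2, Fin.forall_fin_add]

theorem IsPolyhedron.imp (P : Prop) {Q : E → Prop} (hQ : P → IsPolyhedron {y | Q y}) :
    IsPolyhedron {y | P → Q y} := by
  by_cases h : P
  · simpa [h] using hQ h
  · simpa [h] using isPolyhedron_univ (E := E)

theorem IsPolyhedron.forall_finset {κ : Type*} (s : Finset κ) {P : κ → E → Prop}
    (hP : ∀ k, IsPolyhedron {y | P k y}) : IsPolyhedron {y | ∀ k ∈ s, P k y} := by
  classical
  induction s using Finset.induction_on with
  | empty => simpa using isPolyhedron_univ (E := E)
  | insert k s hk ih =>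
    simp only [Finset.forall_mem_insert]
    exact (hP k).and ih

theorem IsPolyhedron.forall {κ : Type*} [Finite κ] {P : κ → E → Prop}
    (hP : ∀ k, IsPolyhedron {y | P k y}) : IsPolyhedron {y | ∀ k, P k y} := by
  cases nonempty_fintype κ
  simpa using IsPolyhedron.forall_finset Finset.univ hP

theorem isPolyhedron_le {f g : E → ℝ} (hf : IsAffineFn f) (hg : IsAffineFn g) :
    IsPolyhedron {y | f y ≤ g y} := by
  obtain ⟨a, b, h⟩ := hf.sub hg
  refine ⟨1, fun _ => a, fun _ => -b, ?_⟩
  ext y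
  have := h y
  simp only [Set.mem_ofPred_eq, forall_const]
  constructor <;> intro _ <;> linarith

theorem isPolyhedron_eq {f g : E → ℝ} (hf : IsAffineFn f) (hg : IsAffineFn g) :
    IsPolyhedron {y | f y = g y} := by
  simpa only [le_antisymm_iff] using (isPolyhedron_le hf hg).and (isPolyhedron_le hg hf)

theorem IsPolyhedron.convex {Q : Set E} (hQ : IsPolyhedron Q) : Convex ℝ Q := by
  obtain ⟨m, a, b, rfl⟩ := hQ
  simp only [Set.ofPred_forall]
  exact convex_iInter fun k => convex_halfSpace_le (a k).isLinear (b k)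

/-! ## Affinity of the building blocks -/

theorem isAffineFn_coord {d : ℕ} {z : E → Fin d → ℝ} (hz : ∀ k, IsAffineFn fun y => z y k)
    (j : ℕ) : IsAffineFn fun y => coord (z y) j := by
  unfold coord
  refine .ite _ (fun _ => .const _) fun _ => ?_
  by_cases h : j - 1 < d
  · simpa [h] using hz ⟨j - 1, h⟩
  · simpa [h] using IsAffineFn.const (E := E) 0

theorem isAffineFn_affineLift {d : ℕ} (g : Fin (d + 1) → ℝ) {z : E → Fin d → ℝ}
    (hz : ∀ k, IsAffineFn fun y => z y k) : IsAffineFn fun y => affineLift g (z y) :=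
  (IsAffineFn.const _).add (.sum _ fun k _ => (hz k).const_mul _)

theorem isAffineFn_switchMap {d : ℕ} (σ : Equiv.Perm (Fin (d + 1))) {z : E → Fin d → ℝ}
    (hz : ∀ k, IsAffineFn fun y => z y k) (k : Fin d) :
    IsAffineFn fun y => switchMap σ (z y) k := by
  unfold switchMap ofLambda toLambda
  exact .sum _ fun _ _ => .ite _
    (fun _ => (isAffineFn_coord hz _).sub (isAffineFn_coord hz _)) fun _ => .const _

variable {ι : Type} [Fintype ι] [DecidableEq ι] {d : ι → ℕ}

theorem isAffineFn_stairAffine (ψ : (∀ i, Fin (d i + 1)) → ℝ) (π : Staircase d)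
    {z : E → ∀ i, Fin (d i) → ℝ} (hz : ∀ i k, IsAffineFn fun y => z y i k) :
    IsAffineFn fun y => stairAffine ψ π (z y) :=
  (IsAffineFn.const _).add (.sum _ fun _ _ => (isAffineFn_coord (hz _) _).const_mul _)

theorem isPolyhedron_le_stairMin (ψ : (∀ i, Fin (d i + 1)) → ℝ) {f : E → ℝ}
    (hf : IsAffineFn f) {z : E → ∀ i, Fin (d i) → ℝ}
    (hz : ∀ i k, IsAffineFn fun y => z y i k) :
    IsPolyhedron {y | f y ≤ stairMin ψ (z y)} := by
  simp only [stairMin, Finset.le_inf'_iff]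
  exact .forall_finset _ fun π => isPolyhedron_le hf (isAffineFn_stairAffine ψ π hz)

end Affine

/-! ## Vertices of the unary simplex -/

theorem coord_vertex {d : ℕ} (j : Fin (d + 1)) (k : ℕ) :
    coord (vertex d j) k = if k ≤ j.val then 1 else 0 := by
  have := j.isLt
  unfold coord vertex
  dsimp only
  split_ifs <;> first | rfl | omega

theorem affineLift_vertex {d : ℕ} (g : Fin (d + 1) → ℝ) (j : Fin (d + 1)) :
    affineLift g (vertex d j) = g j := by
  induction j using Fin.induction with
  | zero => simp [affineLift, vertex]
  | succ j ih =>
    have : affineLift g (vertex d j.succ)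
        = affineLift g (vertex d j.castSucc) + (g j.succ - g j.castSucc) := by
      unfold affineLift vertex
      rw [add_assoc, ← Fintype.sum_ite_eq' j fun k => g k.succ - g k.castSucc,
        ← Finset.sum_add_distrib]
      congr 1
      refine Finset.sum_congr rfl fun k _ => ?_
      have : k = j ↔ k.val = j.val := Fin.ext_iff
      simp only [Fin.val_succ, Fin.val_castSucc, this]
      split_ifs <;> first | omega | simp
    rw [this, ih]
    ring

theorem vertex_mem_unarySimplex {d : ℕ} (j : Fin (d + 1)) : vertex d j ∈ unarySimplex d := by
  refine ⟨fun k => ?_, fun k l hkl => ?_⟩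
  · unfold vertex
    split_ifs <;> norm_num
  · have : k.val ≤ l.val := hkl
    unfold vertex
    split_ifs <;> first | omega | norm_num

/-- The level of a point of the unary simplex at the threshold `s`. -/
noncomputable def level {d : ℕ} (s : ℝ) (z : Fin d → ℝ) : Fin (d + 1) :=
  ⟨(Finset.univ.filter fun k => s ≤ z k).card,
    Nat.lt_succ_of_le ((Finset.card_le_univ _).trans_eq (Fintype.card_fin d))⟩

/-- An initial segment of `Fin d` is determined by its cardinality. -/
theorem lt_card_iff_of_lower {d : ℕ} (P : Fin d → Prop) [DecidablePred P]
    (hP : ∀ k l, k ≤ l → P l → P k) (k : Fin d) :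
    k.val < (Finset.univ.filter P).card ↔ P k := by
  constructor
  · intro h
    by_contra hk
    -- If `P` fails at `k`, it fails from `k` on, so at most `k.val` elements satisfy it.
    have : (Finset.univ.filter P) ⊆ Finset.Iio k := fun l hl => by
      simp only [Finset.mem_filter, Finset.mem_univ, true_and] at hl
      rw [Finset.mem_Iio]
      by_contra hlk
      exact hk (hP k l (not_lt.1 hlk) hl)
    have := Finset.card_le_card this
    rw [Fin.card_Iio] at this
    omega
  · intro h
    have : Finset.Iic k ⊆ Finset.univ.filter P := fun l hl => by
      simpa using hP l k (Finset.mem_Iic.1 hl) h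
    have := Finset.card_le_card this
    rw [Fin.card_Iic] at this
    omega

/-- A superlevel set of an antitone `z` is an initial segment, so counting it loses no information:
rounding at the threshold `s` yields a vertex. -/
theorem vertex_level {d : ℕ} (s : ℝ) {z : Fin d → ℝ} (hz : Antitone z) (k : Fin d) :
    vertex d (level s z) k = if s ≤ z k then 1 else 0 := by
  have := lt_card_iff_of_lower (fun k => s ≤ z k) (fun k l hkl h => h.trans (hz hkl)) k
  simp [vertex, level, this]

/-- A threshold in `(0, 1]` separates the coordinate values 0 and 1, so rounding fixes the vertices.
-/
theorem level_vertex {d : ℕ} {s : ℝ} (hs : 0 < s) (hs1 : s ≤ 1) (j : Fin (d + 1)) :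
    level s (vertex d j) = j := by
  have hj := j.isLt
  have key := vertex_level s (vertex_mem_unarySimplex j).2
  set l := level s (vertex d j) with hl
  have hlt := l.isLt
  have hk : ∀ k : Fin d, k.val < l.val ↔ k.val < j.val := by
    intro k
    have h := key k
    unfold vertex at h
    by_cases h1 : k.val < l.val <;> by_cases h2 : k.val < j.val <;> simp [h1, h2] at h ⊢ <;>
      linarith
  ext
  rcases lt_trichotomy l.val j.val with h | h | h
  · have := (hk ⟨l.val, by omega⟩).2 h
    simp at this
  · exact h
  · have := (hk ⟨j.val, by omega⟩).1 h
    simp at this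

theorem vertex_injective (d : ℕ) : Function.Injective (vertex d) := fun j k h => by
  rw [← level_vertex one_pos le_rfl j, h, level_vertex one_pos le_rfl]

theorem exists_eq_vertex {d : ℕ} {z : Fin d → ℝ} (hz : z ∈ unarySimplex d)
    (hb : ∀ k, z k = 0 ∨ z k = 1) : ∃ j, z = vertex d j := by
  refine ⟨level 1 z, funext fun k => ?_⟩
  rw [vertex_level _ hz.2]
  rcases hb k with h | h <;> simp [h]

theorem toLambda_vertex {d : ℕ} (j k : Fin (d + 1)) :
    toLambda (vertex d j) k = if k = j then 1 else 0 := by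
  have : k = j ↔ k.val = j.val := Fin.ext_iff
  simp only [toLambda, coord_vertex, this]
  split_ifs <;> first | omega | norm_num

/-- The coordinates `toLambda` are barycentric: on a vertex they form an indicator, which the
permutation relabels. -/
theorem switchMap_vertex {d : ℕ} (σ : Equiv.Perm (Fin (d + 1))) (j : Fin (d + 1)) :
    switchMap σ (vertex d j) = vertex d (σ j) := by
  funext k
  simp only [switchMap, ofLambda, toLambda_vertex, Equiv.symm_apply_eq]
  rw [Finset.sum_eq_single (σ j)]
  · simp [vertex]
  · intro l _ hl
    simp [hl]
  · simp

/-! ## Staircase functions of supermodular grid functions -/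

/-- Supermodular functions on a lattice. -/
def Supermodular {α : Type} [Lattice α] (F : α → ℝ) : Prop :=
  ∀ a b, F a + F b ≤ F (a ⊔ b) + F (a ⊓ b)

/-- Write `u`, `v` for the increments of `F` from `a ⊓ b` to `a` and `b`, and `u'`, `v'` for those
of `G`. Replacing both values at `a ⊔ b` by their supermodular lower bounds leaves the surplus `u *
v' + v * u'`, which is non-negative by monotonicity; non-negativity of the factors permits
multiplying the two lower bounds. -/
theorem Supermodular.mul {α : Type} [Lattice α] {F G : α → ℝ}
    (hF : Supermodular F) (hFm : Monotone F) (hF0 : ∀ a, 0 ≤ F a)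
    (hG : Supermodular G) (hGm : Monotone G) (hG0 : ∀ a, 0 ≤ G a) :
    Supermodular fun a => F a * G a := by
  intro a b
  dsimp only
  have f1 := hFm (inf_le_left : a ⊓ b ≤ a)
  have f2 := hFm (inf_le_right : a ⊓ b ≤ b)
  have g1 := hGm (inf_le_left : a ⊓ b ≤ a)
  have g2 := hGm (inf_le_right : a ⊓ b ≤ b)
  have hF' := hF a b
  have hG' := hG a b
  have hm := hF0 (a ⊓ b)
  have hm' := hG0 (a ⊓ b)
  have hprod : (F a + F b - F (a ⊓ b)) * (G a + G b - G (a ⊓ b)) ≤ F (a ⊔ b) * G (a ⊔ b) :=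
    mul_le_mul (by linarith) (by linarith) (by linarith) (hF0 _)
  nlinarith [mul_nonneg (sub_nonneg.2 f1) (sub_nonneg.2 g2),
    mul_nonneg (sub_nonneg.2 f2) (sub_nonneg.2 g1)]

theorem supermodular_prod {α κ : Type} [Lattice α] (s : Finset κ) {F : κ → α → ℝ}
    (hF : ∀ k, Supermodular (F k)) (hm : ∀ k, Monotone (F k)) (h0 : ∀ k a, 0 ≤ F k a) :
    Supermodular fun a => ∏ k ∈ s, F k a := by
  classical
  induction s using Finset.induction_on with
  | empty => intro a b; simp
  | insert k s hk ih =>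
    simp only [Finset.prod_insert hk]
    exact (hF k).mul (hm k) (h0 k) ih
      (fun a b hab => Finset.prod_le_prod (fun _ _ => h0 _ _) fun l _ => hm l hab)
      fun a => Finset.prod_nonneg fun _ _ => h0 _ _

/-! ### Supermodular functions on products of chains -/

section Grid

variable {ι : Type} {d : ι → ℕ}

/-- In a chain, join and meet merely reorder the two coordinates, so functions of one coordinate are
modular. -/
theorem eval_sup_add_inf (i : ι) (F : Fin (d i + 1) → ℝ) (a b : ∀ i, Fin (d i + 1)) :
    F (a i) + F (b i) = F ((a ⊔ b) i) + F ((a ⊓ b) i) := by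
  rw [Pi.sup_apply, Pi.inf_apply]
  rcases le_total (a i) (b i) with h | h
  · rw [sup_of_le_right h, inf_of_le_left h, add_comm]
  · rw [sup_of_le_left h, inf_of_le_right h]

theorem supermodular_eval (i : ι) (F : Fin (d i + 1) → ℝ) :
    Supermodular fun a : ∀ i, Fin (d i + 1) => F (a i) :=
  fun a b => (eval_sup_add_inf i F a b).le

/-- Unlike `Supermodular.mul`, no sign condition is needed: both factors are modular, so their
values at the join are known exactly. This matters because cross-item effects may be negative. -/
theorem supermodular_eval_mul_eval (i j : ι) {F : Fin (d i + 1) → ℝ} {G : Fin (d j + 1) → ℝ}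
    (hF : Monotone F) (hG : Monotone G) :
    Supermodular fun a : ∀ i, Fin (d i + 1) => F (a i) * G (a j) := by
  intro a b
  dsimp only
  have hF' := eval_sup_add_inf i F a b
  have hG' := eval_sup_add_inf j G a b
  have f1 := hF ((inf_le_left : a ⊓ b ≤ a) i)
  have f2 := hF ((inf_le_right : a ⊓ b ≤ b) i)
  have g1 := hG ((inf_le_left : a ⊓ b ≤ a) j)
  have g2 := hG ((inf_le_right : a ⊓ b ≤ b) j)
  rw [show F ((a ⊔ b) i) = F (a i) + F (b i) - F ((a ⊓ b) i) by linarith,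
    show G ((a ⊔ b) j) = G (a j) + G (b j) - G ((a ⊓ b) j) by linarith]
  nlinarith [mul_nonneg (sub_nonneg.2 f1) (sub_nonneg.2 g2),
    mul_nonneg (sub_nonneg.2 f2) (sub_nonneg.2 g1)]

end Grid

/-! ### Staircases and their affine functions at vertices -/

section Staircases

variable {ι : Type} [Fintype ι] [DecidableEq ι] {d : ι → ℕ}

theorem Staircase.gridPt_zero (π : Staircase d) : π.gridPt 0 = ⊥ := by
  funext i
  ext
  simp [Staircase.gridPt]
  rfl

theorem Staircase.gridPt_last (π : Staircase d) : π.gridPt (∑ i, d i) = ⊤ := by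
  funext i
  ext
  have : ∀ s : Fin (∑ i, d i), s.val < ∑ i, d i := fun s => s.isLt
  simp [Staircase.gridPt, this, π.2 i]

theorem Staircase.gridPt_mono (π : Staircase d) : Monotone π.gridPt := by
  intro s t hst i
  simp only [Staircase.gridPt, Fin.mk_le_mk]
  refine Finset.card_le_card fun r hr => ?_
  simp only [Finset.mem_filter, Finset.mem_univ, true_and] at hr ⊢
  exact ⟨hr.1.trans_le hst, hr.2⟩

theorem Staircase.gridPt_succ_val (π : Staircase d) (t : Fin (∑ i, d i)) (i : ι) :
    (π.gridPt (t.val + 1) i).val = (π.gridPt t.val i).val + if π.1 t = i then 1 else 0 := by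
  unfold Staircase.gridPt
  dsimp only
  have hsplit : (Finset.univ.filter fun s : Fin (∑ i, d i) => s.val < t.val + 1 ∧ π.1 s = i)
      = (Finset.univ.filter fun s => s.val < t.val ∧ π.1 s = i)
        ∪ (if π.1 t = i then {t} else ∅) := by
    ext s
    have : s = t ↔ s.val = t.val := Fin.ext_iff
    simp only [Finset.mem_filter, Finset.mem_univ, true_and, Finset.mem_union,
      Nat.lt_succ_iff_lt_or_eq, or_and_right]
    refine or_congr Iff.rfl ⟨fun h => ?_, fun h => ?_⟩
    · obtain rfl := this.2 h.1
      simp [h.2]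
    · split_ifs at h with h2
      · obtain rfl := Finset.mem_singleton.1 h
        exact ⟨rfl, h2⟩
      · simp at h
  rw [hsplit, Finset.card_union_of_disjoint]
  · split_ifs <;> simp
  · split_ifs <;> simp

theorem stairAffine_vertex (ψ : (∀ i, Fin (d i + 1)) → ℝ) (π : Staircase d)
    (j : ∀ i, Fin (d i + 1)) :
    stairAffine ψ π (fun i => vertex (d i) (j i)) = ψ ⊥ + ∑ t : Fin (∑ i, d i),
      if π.gridPt (t.val + 1) (π.1 t) ≤ j (π.1 t)
        then ψ (π.gridPt (t.val + 1)) - ψ (π.gridPt t.val) else 0 := by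
  unfold stairAffine
  rw [π.gridPt_zero]
  congr 1
  refine Finset.sum_congr rfl fun t _ => ?_
  rw [coord_vertex]
  simp only [mul_ite, mul_one, mul_zero]
  rfl

theorem sum_gridPt_sub (π : Staircase d) (φ : (∀ i, Fin (d i + 1)) → ℝ) :
    ∑ t : Fin (∑ i, d i), (φ (π.gridPt (t.val + 1)) - φ (π.gridPt t.val)) = φ ⊤ - φ ⊥ := by
  rw [Fin.sum_univ_eq_sum_range fun t => φ (π.gridPt (t + 1)) - φ (π.gridPt t),
    Finset.sum_range_sub fun t => φ (π.gridPt t), π.gridPt_zero, π.gridPt_last]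

/-- Moves of a staircase that stay below `j` in their direction are moves of its meet with `j`,
the other moves are not seen by the meet. -/
theorem gridPt_succ_inf (π : Staircase d) (j : ∀ i, Fin (d i + 1)) (t : Fin (∑ i, d i)) :
    if π.gridPt (t.val + 1) (π.1 t) ≤ j (π.1 t)
      then π.gridPt (t.val + 1) ≤ π.gridPt t.val ⊔ j
      else π.gridPt (t.val + 1) ⊓ j = π.gridPt t.val ⊓ j := by
  have hs := π.gridPt_succ_val t
  split_ifs with h
  · intro i
    by_cases hi : π.1 t = i
    · subst hi
      exact h.trans le_sup_right
    · refine le_trans ?_ (le_sup_left : π.gridPt t.val i ≤ _)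
      have := hs i
      rw [if_neg hi] at this
      exact this.le
  · funext i
    have hsi := hs i
    by_cases hi : π.1 t = i
    · subst hi
      rw [if_pos rfl] at hsi
      rw [not_le] at h
      have h2 : (j (π.1 t)).val < (π.gridPt (t.val + 1) (π.1 t)).val := h
      have h3 : j (π.1 t) ≤ π.gridPt t.val (π.1 t) := by
        rw [Fin.le_def]
        omega
      rw [Pi.inf_apply, Pi.inf_apply, inf_of_le_right h.le, inf_of_le_right h3]
    · rw [if_neg hi] at hsi
      rw [Pi.inf_apply, Pi.inf_apply, Fin.ext hsi]

/-- Meeting the staircase with `j` gives a path from `⊥` to `j`, along which `ψ` telescopes. A move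
not seen by the meet contributes 0 on both sides; for every other move, supermodularity says that
the increment of `ψ` along the meet is at most the increment along the staircase. -/
theorem le_stairAffine_vertex {ψ : (∀ i, Fin (d i + 1)) → ℝ} (hψ : Supermodular ψ)
    (π : Staircase d) (j : ∀ i, Fin (d i + 1)) :
    ψ j ≤ stairAffine ψ π (fun i => vertex (d i) (j i)) := by
  have hsum := sum_gridPt_sub π fun a => ψ (a ⊓ j)
  simp only [top_inf_eq, bot_inf_eq] at hsum
  rw [stairAffine_vertex, ← sub_le_iff_le_add', ← hsum]
  refine Finset.sum_le_sum fun t _ => ?_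
  have h := gridPt_succ_inf π j t
  split_ifs at h ⊢ with h1
  · have hmono : π.gridPt t.val ≤ π.gridPt (t.val + 1) := π.gridPt_mono (Nat.le_succ _)
    -- The join of these two points is the next staircase point, and their meet is the current one
    -- met with `j`.
    have key := hψ (π.gridPt t.val) (π.gridPt (t.val + 1) ⊓ j)
    rw [sup_inf_left, sup_of_le_right hmono, inf_of_le_left h, ← inf_assoc,
      inf_of_le_left hmono] at key
    linarith
  · rw [h, sub_self]

/-- Same telescoping as in `le_stairAffine_vertex`, now exact for arbitrary `ψ`: the moves counted
at this vertex all occur among the first `m`, where meeting with the `m`-th grid point changes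
nothing. -/
theorem stairAffine_vertex_gridPt (ψ : (∀ i, Fin (d i + 1)) → ℝ) (π : Staircase d) (m : ℕ) :
    stairAffine ψ π (fun i => vertex (d i) (π.gridPt m i)) = ψ (π.gridPt m) := by
  have hsum := sum_gridPt_sub π fun a => ψ (a ⊓ π.gridPt m)
  simp only [top_inf_eq, bot_inf_eq] at hsum
  rw [stairAffine_vertex, ← eq_sub_iff_add_eq', ← hsum]
  refine Finset.sum_congr rfl fun t _ => ?_
  have h := gridPt_succ_inf π (π.gridPt m) t
  split_ifs at h ⊢ with h1
  · have hlt : t.val + 1 ≤ m := by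
      by_contra hlt
      have h2 : π.gridPt m (π.1 t) ≤ π.gridPt t.val (π.1 t) := π.gridPt_mono (by omega) _
      have h3 := π.gridPt_succ_val t (π.1 t)
      rw [if_pos rfl] at h3
      have h4 := Fin.le_def.1 (h1.trans h2)
      omega
    rw [inf_of_le_left (π.gridPt_mono hlt), inf_of_le_left (π.gridPt_mono (by omega))]
  · rw [h, sub_self]

/-- A staircase that takes its moves in the order of decreasing coordinates of `z` passes through
all the grid points of levels of `z`. -/
theorem exists_staircase_levels (z : ∀ i, Fin (d i) → ℝ) :
    ∃ π : Staircase d, ∀ s : ℝ, ∃ m, (fun i => level s (z i)) = π.gridPt m := by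
  have hc : Fintype.card (Fin (∑ i, d i)) = Fintype.card (Σ i, Fin (d i)) := by simp
  let e₀ := Fintype.equivOfCardEq hc
  -- All coordinates of all blocks are listed in non-increasing order. Ties are harmless: the
  -- staircase records only the block of each move.
  let e := (Tuple.sort fun r => -z (e₀ r).1 (e₀ r).2).trans e₀
  have he : ∀ r r', r ≤ r' → z (e r').1 (e r').2 ≤ z (e r).1 (e r).2 := fun r r' h =>
    neg_le_neg_iff.1 (Tuple.monotone_sort (fun r => -z (e₀ r).1 (e₀ r).2) h)
  -- Counting positions of the list that belong to block `i` amounts to counting coordinates of that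
  -- block.
  have hcard : ∀ (i : ι) (P : Fin (d i) → Prop) [DecidablePred P]
      (Q : Fin (∑ i, d i) → Prop) [DecidablePred Q],
      (∀ k, P k ↔ Q (e.symm ⟨i, k⟩)) → (∀ r, Q r → (e r).1 = i) →
      (Finset.univ.filter Q).card = (Finset.univ.filter P).card := by
    intro i P _ Q _ hPQ hQ
    symm
    refine Finset.card_bij (fun k _ => e.symm ⟨i, k⟩) (fun k hk => ?_) (fun k _ l _ h => ?_)
      fun r hr => ?_
    · simpa [hPQ] using hk
    · simpa using h
    · simp only [Finset.mem_filter, Finset.mem_univ, true_and] at hr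
      have h1 := hQ r hr
      obtain ⟨⟨i', k⟩, rfl⟩ := e.symm.surjective r
      simp only [Equiv.apply_symm_apply] at h1
      subst h1
      exact ⟨k, by simpa [hPQ] using hr, rfl⟩
  refine ⟨⟨fun r => (e r).1, fun i => ?_⟩, fun s => ?_⟩
  · rw [hcard i (fun _ => True) _ (by simp) fun r h => h]
    simp
  -- The coordinates that are at least `s` fill the first `m` positions of the sorted list, where
  -- `m` is their number.
  · refine ⟨(Finset.univ.filter fun r => s ≤ z (e r).1 (e r).2).card, ?_⟩
    have hlow := lt_card_iff_of_lower (fun r => s ≤ z (e r).1 (e r).2)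
      fun r r' hrr h => h.trans (he r r' hrr)
    funext i
    ext
    simp only [Staircase.gridPt, level, hlow]
    symm
    exact hcard i _ _ (fun k => by rw [Equiv.apply_symm_apply]; simp) fun r h => h.2

/-- Every staircase bounds `ψ j` from above; sorting the coordinates of the vertex itself produces a
staircase through `j`, where the bound is tight. -/
theorem stairMin_vertex {ψ : (∀ i, Fin (d i + 1)) → ℝ} (hψ : Supermodular ψ)
    (j : ∀ i, Fin (d i + 1)) : stairMin ψ (fun i => vertex (d i) (j i)) = ψ j := by
  refine le_antisymm ?_ (Finset.le_inf' _ _ fun π _ => le_stairAffine_vertex hψ π j)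
  obtain ⟨π, hπ⟩ := exists_staircase_levels fun i => vertex (d i) (j i)
  obtain ⟨m, hm⟩ := hπ 1
  simp only [level_vertex one_pos le_rfl] at hm
  change j = _ at hm
  refine (Finset.inf'_le _ (Finset.mem_univ π)).trans_eq ?_
  rw [hm]
  exact stairAffine_vertex_gridPt ψ π m

theorem switchedStair_vertex (σ : ∀ i, Equiv.Perm (Fin (d i + 1)))
    {h : (∀ i, Fin (d i) → ℝ) → ℝ}
    (hψ : Supermodular fun j : ∀ i, Fin (d i + 1) => h fun i => vertex (d i) (σ i (j i)))
    (j : ∀ i, Fin (d i + 1)) :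
    switchedStair σ h (fun i => vertex (d i) (j i)) = h fun i => vertex (d i) (j i) := by
  unfold switchedStair
  simp only [switchMap_vertex]
  rw [stairMin_vertex hψ fun i => (σ i).symm (j i)]
  simp

/-! ## Decomposition along thresholds -/

/-- Weights on thresholds `s ∈ S`, such that every `v ∈ S` is the weight of the thresholds up to
`v`. -/
theorem exists_threshold_weights (S : Finset ℝ) (hS : ∀ s ∈ S, 0 < s) :
    ∃ w : ℝ → ℝ, (∀ s ∈ S, 0 ≤ w s) ∧
      (∀ v ∈ S, ∑ s ∈ S, w s * (if s ≤ v then 1 else 0) = v) ∧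
      ∀ b, 0 ≤ b → (∀ s ∈ S, s ≤ b) → ∑ s ∈ S, w s ≤ b := by
  induction S using Finset.induction_on_max with
  | empty => exact ⟨0, by simp, by simp, by simp⟩
  | insert a S ha ih =>
    obtain ⟨w, h0, h1, h2⟩ := ih fun s hs => hS s (Finset.mem_insert_of_mem hs)
    have haS : a ∉ S := fun h => lt_irrefl _ (ha a h)
    have ha0 : 0 < a := hS a (Finset.mem_insert_self _ _)
    have hne : ∀ s ∈ S, s ≠ a := fun s hs => (ha s hs).ne
    -- The new largest threshold receives what the total lacks to reach `a`. The bound on the total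
    -- in the induction hypothesis, taken at `a`, makes this weight non-negative.
    let w' := Function.update w a (a - ∑ s ∈ S, w s)
    have hwa : w' a = a - ∑ s ∈ S, w s := Function.update_self ..
    have hws : ∀ s ∈ S, w' s = w s := fun s hs => Function.update_of_ne (hne s hs) ..
    have htot : ∑ s ∈ insert a S, w' s = a := by
      rw [Finset.sum_insert haS, hwa, Finset.sum_congr rfl hws]
      ring
    refine ⟨w', fun s hs => ?_, fun v hv => ?_, fun b _ hb => ?_⟩
    · rcases Finset.mem_insert.1 hs with rfl | hs
      · rw [hwa]
        exact sub_nonneg.2 (h2 _ ha0.le fun s hs => (ha s hs).le)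
      · rw [hws s hs]
        exact h0 s hs
    · rcases Finset.mem_insert.1 hv with rfl | hv
      · refine Eq.trans (Finset.sum_congr rfl fun s hs => ?_) htot
        have : s ≤ v := by
          rcases Finset.mem_insert.1 hs with rfl | hs
          exacts [le_rfl, (ha s hs).le]
        simp [this]
      · rw [Finset.sum_insert haS, if_neg (not_le.2 (ha v hv)), mul_zero, zero_add]
        refine Eq.trans (Finset.sum_congr rfl fun s hs => ?_) (h1 v hv)
        rw [hws s hs]
    · rw [htot]
      exact hb a (Finset.mem_insert_self _ _)

/-- A single staircase passes through the levels of `z` at all thresholds, so its affine function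
equals `ψ` at each of them and averages exactly. Supermodularity is not involved. -/
theorem stairMin_le_sum_levels (ψ : (∀ i, Fin (d i + 1)) → ℝ) {z : ∀ i, Fin (d i) → ℝ}
    (S : Finset ℝ) (w : ℝ → ℝ) (hw : ∑ s ∈ S, w s = 1)
    (hz : ∀ i, ∑ s ∈ S, w s • vertex (d i) (level s (z i)) = z i) :
    stairMin ψ z ≤ ∑ s ∈ S, w s * ψ (fun i => level s (z i)) := by
  obtain ⟨π, hπ⟩ := exists_staircase_levels z
  refine (Finset.inf'_le _ (Finset.mem_univ π)).trans_eq ?_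
  have haff : IsAffineFn (stairAffine ψ π) :=
    isAffineFn_stairAffine ψ π (z := id) fun i k =>
      .linear ((LinearMap.proj k).comp (LinearMap.proj (R := ℝ) (φ := fun i => Fin (d i) → ℝ) i))
  have hsum : z = ∑ s ∈ S, w s • fun i => vertex (d i) (level s (z i)) := by
    funext i
    rw [Finset.sum_apply]
    exact (hz i).symm
  conv_lhs => rw [hsum]
  rw [haff.map_sum S w hw]
  refine Finset.sum_congr rfl fun s _ => ?_
  obtain ⟨m, hm⟩ := hπ s
  congr 1
  rw [hm, ← stairAffine_vertex_gridPt ψ π m, ← hm]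

end Staircases

variable {n T M : ℕ}

/-! ## Price levels -/

/-- A choice of a ladder level for every item and period. -/
abbrev Data.Levels (D : Data n T M) : Type := ∀ i : Fin n, Fin T → Fin (D.d i + 1)

/-- The plan that belongs to the levels `J`. -/
def Data.planOf (D : Data n T M) (J : D.Levels) : Plan n T := fun i t => D.p i (J i t)

/-- The binarization of the levels `J`. -/
def Data.zOf (D : Data n T M) (J : D.Levels) : D.ZVar := fun i t => vertex (D.d i) (J i t)

/-- The level of item `i`, `k` periods before `t`. -/
def Data.lagLevel (D : Data n T M) (J : D.Levels) (i : Fin n) (t : Fin T) (k : ℕ) :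
    Fin (D.d i + 1) :=
  if k ≤ t.val then J i ⟨t.val - k, (Nat.sub_le _ _).trans_lt t.isLt⟩
  else D.hist i (k - t.val - 1)

/-- The period term on ladder levels. -/
def Data.periodGrid (D : Data n T M) (i : Fin n) (t : Fin T)
    (a : Fin (M + 1) → Fin (D.d i + 1)) : ℝ :=
  (D.p i (a 0) - D.c i t) * D.f i i t (D.p i (a 0)) * ∏ k : Fin M, D.h i t k (D.p i (a k.succ))

/-- The profit of item `i` in period `t` without cross-item effects. -/
def Data.periodProfit (D : Data n T M) (J : D.Levels) (i : Fin n) (t : Fin T) : ℝ :=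
  D.periodGrid i t fun k => D.lagLevel J i t k.val

/-- The contribution of the price of item `j` to the profit of item `i` in period `t`. -/
def Data.itemProfit (D : Data n T M) (J : D.Levels) (i j : Fin n) (t : Fin T) : ℝ :=
  (D.p i (J i t) - D.c i t) * D.f i j t (D.p j (J j t))

/-- The point of the formulation over the levels `J` with the largest objective value. -/
def Data.pointOf (D : Data n T M) (J : D.Levels) : D.Var :=
  (D.planOf J, D.zOf J, D.periodProfit J, fun i j t => D.itemProfit J i j t)

theorem Data.liftFn_vertex (D : Data n T M) (i : Fin n) (φ : ℝ → ℝ) (j : Fin (D.d i + 1)) :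
    D.liftFn i φ (vertex (D.d i) j) = φ (D.p i j) :=
  affineLift_vertex _ _

theorem Data.lagPrice_planOf (D : Data n T M) (J : D.Levels) (i : Fin n) (t : Fin T) (k : ℕ) :
    D.lagPrice (D.planOf J) i t k = D.p i (D.lagLevel J i t k) := by
  unfold Data.lagPrice Data.lagLevel Data.planOf
  split_ifs <;> rfl

theorem Data.lagZ_zOf (D : Data n T M) (J : D.Levels) (i : Fin n) (t : Fin T) (k : ℕ) :
    D.lagZ (D.zOf J) i t k = vertex (D.d i) (D.lagLevel J i t k) := by
  unfold Data.lagZ Data.lagLevel Data.zOf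
  split_ifs <;> rfl

theorem Data.periodTerm_vertex (D : Data n T M) (i : Fin n) (t : Fin T)
    (a : Fin (M + 1) → Fin (D.d i + 1)) :
    D.periodTerm i t (fun k => vertex (D.d i) (a k)) = D.periodGrid i t a := by
  simp only [Data.periodTerm, Data.liftFn_vertex, Data.periodGrid]

theorem Data.itemTerm_vertex (D : Data n T M) (i j : Fin n) (t : Fin T)
    (a : ∀ b : Fin 2, Fin (D.d (![i, j] b) + 1)) :
    D.itemTerm i j t (fun b => vertex (D.d (![i, j] b)) (a b))
      = (D.p i (a 0) - D.c i t) * D.f i j t (D.p j (a 1)) :=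
  congrArg₂ (· * ·) (D.liftFn_vertex i (fun y => y - D.c i t) (a 0))
    (D.liftFn_vertex j (D.f i j t) (a 1))

theorem Data.profit_planOf (D : Data n T M) (J : D.Levels) :
    D.profit (D.planOf J) = D.objective (D.pointOf J) := by
  unfold Data.profit Data.objective Data.demand
  refine Finset.sum_congr rfl fun i _ => Finset.sum_congr rfl fun t _ => ?_
  rw [mul_add, Finset.mul_sum, ← mul_assoc]
  refine congrArg₂ (· + ·) (congrArg₂ (· * ·) rfl ?_) rfl
  refine Finset.prod_congr rfl fun k _ => ?_
  rw [D.lagPrice_planOf]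
  rfl

theorem Data.objective_isLinearMap (D : Data n T M) : IsLinearMap ℝ D.objective where
  map_add x y := by
    simp only [Data.objective, Prod.fst_add, Prod.snd_add, Pi.add_apply, Finset.sum_add_distrib]
    ring
  map_smul r x := by
    simp only [Data.objective, Prod.smul_fst, Prod.smul_snd, Pi.smul_apply, smul_eq_mul,
      ← Finset.mul_sum, ← mul_add]

theorem Data.objective_mono (D : Data n T M) {y y' : D.Var} (hμ : y.2.2.1 ≤ y'.2.2.1)
    (hν : y.2.2.2 ≤ y'.2.2.2) : D.objective y ≤ D.objective y' :=
  Finset.sum_le_sum fun i _ => Finset.sum_le_sum fun t _ =>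
    add_le_add (hμ i t) (Finset.sum_le_sum fun j _ => hν i j t)

/-! ## Supermodularity of the profit terms -/

theorem Data.supermodular_periodGrid (D : Data n T M) (hp : ∀ i, StrictMono (D.p i))
    (hc : ∀ i t, D.c i t ≤ D.p i 0)
    (hf : ∀ i t, ∀ y ∈ D.ladder i, 0 ≤ D.f i i t y)
    (hh : ∀ i t k, ∀ y ∈ D.ladder i, 0 ≤ D.h i t k y)
    (hl : ∀ i t, MonotoneOn (fun y => (y - D.c i t) * D.f i i t y) (D.ladder i))
    (hdip : ∀ i t k, MonotoneOn (D.h i t k) (D.ladder i)) (i : Fin n) (t : Fin T) :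
    Supermodular (D.periodGrid i t) := by
  have hpl : ∀ j, D.p i j ∈ D.ladder i := fun j => Set.mem_range_self j
  have hh0 : ∀ k j, 0 ≤ D.h i t k (D.p i j) := fun k j => hh i t k _ (hpl j)
  have hhm : ∀ k, Monotone fun j => D.h i t k (D.p i j) := fun k j j' hjj =>
    hdip i t k (hpl j) (hpl j') ((hp i).monotone hjj)
  have hF : Supermodular fun a : Fin (M + 1) → Fin (D.d i + 1) =>
      (D.p i (a 0) - D.c i t) * D.f i i t (D.p i (a 0)) :=
    supermodular_eval (d := fun _ : Fin (M + 1) => D.d i) 0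
      fun j => (D.p i j - D.c i t) * D.f i i t (D.p i j)
  refine hF.mul (fun a b hab => hl i t (hpl _) (hpl _) ((hp i).monotone (hab 0)))
    (fun a => mul_nonneg (sub_nonneg.2 ((hc i t).trans ((hp i).monotone (Fin.zero_le _))))
      (hf i t _ (hpl _)))
    (supermodular_prod _ (fun k => ?_) (fun k a b hab => hhm k (hab _)) fun k a => hh0 k _)
    (fun a b hab => Finset.prod_le_prod (fun _ _ => hh0 _ _) fun k _ => hhm k (hab _))
    fun a => Finset.prod_nonneg fun k _ => hh0 k _
  exact supermodular_eval (d := fun _ : Fin (M + 1) => D.d i) k.succ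
    fun j => D.h i t k (D.p i j)

theorem Data.stair_periodTerm_vertex (D : Data n T M) {i : Fin n} {t : Fin T}
    (hs : Supermodular (D.periodGrid i t)) (J : D.Levels) :
    stair (d := fun _ : Fin (M + 1) => D.d i) (D.periodTerm i t)
      (fun a => D.lagZ (D.zOf J) i t a.val) = D.periodProfit J i t := by
  unfold stair
  simp only [D.lagZ_zOf, D.periodTerm_vertex]
  exact stairMin_vertex (d := fun _ : Fin (M + 1) => D.d i) hs _

theorem Data.stair_itemTerm_vertex (D : Data n T M) (hp : ∀ i, StrictMono (D.p i))
    {i j : Fin n} (hij : D.Substitutable i j) (t : Fin T) (J : D.Levels) :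
    stair (d := fun a => D.d (![i, j] a)) (D.itemTerm i j t)
      (fun a => D.zOf J (![i, j] a) t) = D.itemProfit J i j t := by
  unfold stair
  simp only [D.itemTerm_vertex, Data.zOf]
  refine stairMin_vertex (d := fun a => D.d (![i, j] a)) ?_ fun a => J (![i, j] a) t
  exact supermodular_eval_mul_eval (d := fun a => D.d (![i, j] a)) 0 1
    (F := fun k => D.p i k - D.c i t) (G := fun k => D.f i j t (D.p j k))
    (fun a b hab => sub_le_sub_right ((hp i).monotone hab) _)
    (fun a b hab => (hij t).1 (Set.mem_range_self _) (Set.mem_range_self _)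
      ((hp j).monotone hab))

/-- Reading the second ladder backwards turns the non-increasing cross effect into a non-decreasing
one, which reduces to the supermodular case. -/
theorem Data.rvsStair_itemTerm_vertex (D : Data n T M) (hp : ∀ i, StrictMono (D.p i))
    {i j : Fin n} (hij : D.Complementary i j) (t : Fin T) (J : D.Levels) :
    rvsStair (d := fun a => D.d (![i, j] a)) (D.itemTerm i j t)
      (fun a => D.zOf J (![i, j] a) t) = D.itemProfit J i j t := by
  refine (switchedStair_vertex (d := fun a => D.d (![i, j] a)) _ ?_
    fun a => J (![i, j] a) t).trans (D.itemTerm_vertex i j t fun a => J (![i, j] a) t)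
  simp only [D.itemTerm_vertex]
  exact supermodular_eval_mul_eval (d := fun a => D.d (![i, j] a)) 0 1
    (F := fun k => D.p i k - D.c i t) (G := fun k => D.f i j t (D.p j (Fin.rev k)))
    (fun a b hab => sub_le_sub_right ((hp i).monotone hab) _)
    (fun a b hab => (hij t).1 (Set.mem_range_self _) (Set.mem_range_self _)
      ((hp j).monotone (Fin.rev_le_rev.2 hab)))

/-! ## The business rules -/

/-- The convention `z_0 = 1` in `coord` covers a ladder with a single price, where no promotion is
possible. -/
theorem Data.coord_eq_one_sub_promo (D : Data n T M) (hp : ∀ i, StrictMono (D.p i)) (J : D.Levels)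
    (i : Fin n) (t : Fin T) :
    coord (D.zOf J i t) (D.d i) = 1 - (D.promo (D.planOf J) i t : ℝ) := by
  have hJ := (J i t).isLt
  have h1 : D.p i (J i t) < D.p i (Fin.last (D.d i)) ↔ (J i t).val < D.d i := by
    rw [(hp i).lt_iff_lt, Fin.lt_def, Fin.val_last]
  simp only [Data.zOf, coord_vertex, Data.promo, Data.planOf, h1]
  split_ifs <;> first | omega | norm_num

theorem Data.zRules_iff (D : Data n T M) (hp : ∀ i, StrictMono (D.p i))
    (B : BusinessRules n T) (J : D.Levels) :
    D.ZRules B (D.zOf J) ↔ D.PriceRules B (D.planOf J) := by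
  unfold Data.ZRules Data.PriceRules
  simp only [D.coord_eq_one_sub_promo hp, Finset.sum_sub_distrib, Finset.sum_const, nsmul_eq_mul,
    mul_one, Finset.card_univ, Fintype.card_fin, ← Nat.cast_sum]
  refine and_congr (forall_congr' fun i => ?_) (and_congr (forall_congr' fun t => ?_)
    (and_congr ?_ (forall_congr' fun i => forall_congr' fun k => imp_congr_right fun hk => ?_)))
  · rw [sub_le_sub_iff_left, Nat.cast_le]
  · rw [sub_le_sub_iff_left, Nat.cast_le]
  · simp only [sub_right_inj, Nat.cast_inj]
  -- The window has `τ + 1` periods, so at least `τ` periods without promotion means at most one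
  -- promotion.
  · have hcard : (Finset.univ.filter fun t : Fin T => k ≤ t.val ∧ t.val ≤ k + B.τ i).card
        = B.τ i + 1 := by
      have : (Finset.univ.filter fun t : Fin T => k ≤ t.val ∧ t.val ≤ k + B.τ i)
          = Finset.Icc (⟨k, by omega⟩ : Fin T) ⟨k + B.τ i, hk⟩ := by
        ext t
        simp [Fin.le_def]
      rw [this, Fin.card_Icc]
      simp only
      omega
    rw [hcard, ← Nat.cast_le (α := ℝ) (n := 1)]
    push_cast
    constructor <;> intro h <;> linarith

theorem Data.feasible_nonempty (D : Data n T M) (R : Option (BusinessRules n T)) :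
    (D.feasible R).Nonempty := by
  refine ⟨fun i _ => D.p i (Fin.last _), fun i t => Set.mem_range_self _, fun B _ => ?_⟩
  simp [Data.PriceRules, Data.promo]

theorem Data.feasible_finite (D : Data n T M) (R : Option (BusinessRules n T)) :
    (D.feasible R).Finite := by
  refine (Set.finite_range D.planOf).subset fun x hx => ?_
  choose J hJ using hx.1
  exact ⟨J, funext fun i => funext fun t => hJ i t⟩

theorem Data.exists_levels (D : Data n T M) {R : Option (BusinessRules n T)} {x : Plan n T}
    (hx : x ∈ D.feasible R) : ∃ J, x = D.planOf J := by
  choose J hJ using hx.1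
  exact ⟨J, funext fun i => funext fun t => (hJ i t).symm⟩

/-! ## The formulation -/

section Components

variable (D : Data n T M)

theorem Data.isAffineFn_x (i : Fin n) (t : Fin T) : IsAffineFn fun y : D.Var => y.1 i t :=
  ⟨⟨⟨fun y => y.1 i t, fun _ _ => rfl⟩, fun _ _ => rfl⟩, 0, fun _ => (add_zero _).symm⟩

theorem Data.isAffineFn_z (i : Fin n) (t : Fin T) (k : Fin (D.d i)) :
    IsAffineFn fun y : D.Var => y.2.1 i t k :=
  ⟨⟨⟨fun y => y.2.1 i t k, fun _ _ => rfl⟩, fun _ _ => rfl⟩, 0, fun _ => (add_zero _).symm⟩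

theorem Data.isAffineFn_mu (i : Fin n) (t : Fin T) :
    IsAffineFn fun y : D.Var => y.2.2.1 i t :=
  ⟨⟨⟨fun y => y.2.2.1 i t, fun _ _ => rfl⟩, fun _ _ => rfl⟩, 0, fun _ => (add_zero _).symm⟩

theorem Data.isAffineFn_nu (i : Fin n) (j : {j : Fin n // j ≠ i}) (t : Fin T) :
    IsAffineFn fun y : D.Var => y.2.2.2 i j t :=
  ⟨⟨⟨fun y => y.2.2.2 i j t, fun _ _ => rfl⟩, fun _ _ => rfl⟩, 0, fun _ => (add_zero _).symm⟩

theorem Data.isAffineFn_lagZ (i : Fin n) (t : Fin T) (s : ℕ) (k : Fin (D.d i)) :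
    IsAffineFn fun y : D.Var => D.lagZ y.2.1 i t s k := by
  unfold Data.lagZ
  by_cases h : s ≤ t.val
  · simpa only [h, if_true] using D.isAffineFn_z i _ k
  · simpa only [h, if_false] using IsAffineFn.const _

end Components

theorem isPolyhedron_unarySimplex {E : Type} [AddCommGroup E] [Module ℝ E] {d : ℕ}
    {z : E → Fin d → ℝ} (hz : ∀ k, IsAffineFn fun y => z y k) :
    IsPolyhedron {y | z y ∈ unarySimplex d} := by
  refine IsPolyhedron.and (.forall fun k => ?_) (.forall fun k => .forall fun l =>
    .imp _ fun _ => isPolyhedron_le (hz _) (hz _))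
  exact (isPolyhedron_le (.const _) (hz k)).and (isPolyhedron_le (hz k) (.const _))

theorem Data.isPolyhedron_zRules (D : Data n T M) (B : BusinessRules n T) :
    IsPolyhedron {y : D.Var | D.ZRules B y.2.1} := by
  have hcoord : ∀ i t, IsAffineFn fun y : D.Var => coord (y.2.1 i t) (D.d i) :=
    fun i t => isAffineFn_coord (D.isAffineFn_z i t) _
  -- The window start ranges over `ℕ`; only starts below `T` matter, which leaves finitely many
  -- inequalities.
  have hwin : ∀ (i : Fin n) (y : D.Var), (∀ k : ℕ, k + B.τ i < T → (B.τ i : ℝ) ≤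
      ∑ t ∈ Finset.univ.filter (fun t : Fin T => k ≤ t.val ∧ t.val ≤ k + B.τ i),
        coord (y.2.1 i t) (D.d i)) ↔ ∀ k : Fin T, k.val + B.τ i < T → (B.τ i : ℝ) ≤
      ∑ t ∈ Finset.univ.filter (fun t : Fin T => k.val ≤ t.val ∧ t.val ≤ k.val + B.τ i),
        coord (y.2.1 i t) (D.d i) :=
    fun i y => ⟨fun h k hk => h k hk, fun h k hk => h ⟨k, by omega⟩ hk⟩
  unfold Data.ZRules
  simp only [hwin]
  refine IsPolyhedron.and (.forall fun i =>
      isPolyhedron_le (.const _) (.sum _ fun _ _ => hcoord _ _))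
    (IsPolyhedron.and (.forall fun t => isPolyhedron_le (.const _) (.sum _ fun _ _ => hcoord _ _))
    (IsPolyhedron.and (.forall fun t => .forall fun i => .imp _ fun _ => .forall fun j =>
      .imp _ fun _ =>
      isPolyhedron_eq (hcoord _ _) (hcoord _ _))
    (.forall fun i => .forall fun k => .imp _ fun _ =>
      isPolyhedron_le (.const _) (.sum _ fun _ _ => hcoord _ _))))

theorem Data.isPolyhedron_lpRegion (D : Data n T M) (R : Option (BusinessRules n T)) :
    IsPolyhedron (D.lpRegion R) := by
  refine IsPolyhedron.and (.forall fun i => .forall fun t => IsPolyhedron.and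
    (isPolyhedron_eq (D.isAffineFn_x i t) (isAffineFn_affineLift _ (D.isAffineFn_z i t)))
    (isPolyhedron_unarySimplex (D.isAffineFn_z i t))) (IsPolyhedron.and ?_ (IsPolyhedron.and
    (.forall fun i => .forall fun t => ?_) (IsPolyhedron.and
    (.forall fun i => .forall fun t => .forall fun j => .imp _ fun _ => ?_)
    (.forall fun i => .forall fun t => .forall fun j => .imp _ fun _ => ?_))))
  · cases R with
    | none => simpa using isPolyhedron_univ (E := D.Var)
    | some B => simpa using D.isPolyhedron_zRules B
  · exact isPolyhedron_le_stairMin (d := fun _ : Fin (M + 1) => D.d i) _ (D.isAffineFn_mu i t)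
      fun a k => D.isAffineFn_lagZ i t a.val k
  · exact isPolyhedron_le_stairMin (d := fun a => D.d (![i, j.1] a)) _ (D.isAffineFn_nu i j t)
      fun a k => D.isAffineFn_z _ t k
  · exact isPolyhedron_le_stairMin (d := fun a => D.d (![i, j.1] a)) _ (D.isAffineFn_nu i j t)
      fun a k => isAffineFn_switchMap _ (D.isAffineFn_z _ t) k

/-- The points of the MIP formulation, in terms of price levels. -/
theorem Data.mem_mipRegion_iff (D : Data n T M) (hp : ∀ i, StrictMono (D.p i))
    (hs : ∀ i t, Supermodular (D.periodGrid i t))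
    (hsc : ∀ i j, i ≠ j → D.Substitutable i j ∨ D.Complementary i j)
    (R : Option (BusinessRules n T)) (y : D.Var) :
    y ∈ D.mipRegion R ↔ ∃ J, y.1 = D.planOf J ∧ y.2.1 = D.zOf J ∧ D.planOf J ∈ D.feasible R ∧
      y.2.2.1 ≤ (D.pointOf J).2.2.1 ∧ y.2.2.2 ≤ (D.pointOf J).2.2.2 := by
  obtain ⟨x, z, μ, ν⟩ := y
  constructor
  · rintro ⟨⟨hxz, hB, hμ, hsub, hcom⟩, hbin⟩
    choose J hJ using fun i t => exists_eq_vertex (hxz i t).2 (hbin i t)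
    obtain rfl : z = D.zOf J := funext fun i => funext fun t => hJ i t
    have hx : x = D.planOf J := funext fun i => funext fun t => by
      rw [(hxz i t).1]
      exact D.liftFn_vertex i id (J i t)
    refine ⟨J, hx, rfl, ⟨fun i t => Set.mem_range_self _, fun B hR =>
      (D.zRules_iff hp B J).1 (hB B hR)⟩, fun i t => ?_, fun i j t => ?_⟩
    · exact (hμ i t).trans_eq (D.stair_periodTerm_vertex (hs i t) J)
    · rcases hsc i j j.2.symm with h | h
      · exact (hsub i t j h).trans_eq (D.stair_itemTerm_vertex hp h t J)
      · exact (hcom i t j h).trans_eq (D.rvsStair_itemTerm_vertex hp h t J)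
  · rintro ⟨J, hx, hz, hfeas, hμ, hν⟩
    dsimp only at hx hz hμ hν
    subst hx hz
    refine ⟨⟨fun i t => ⟨(D.liftFn_vertex i id (J i t)).symm, vertex_mem_unarySimplex _⟩,
      fun B hR => (D.zRules_iff hp B J).2 (hfeas.2 B hR), fun i t => ?_, fun i t j h => ?_,
      fun i t j h => ?_⟩, fun i t k => ?_⟩
    · exact (hμ i t).trans_eq (D.stair_periodTerm_vertex (hs i t) J).symm
    · exact (hν i j t).trans_eq (D.stair_itemTerm_vertex hp h t J).symm
    · exact (hν i j t).trans_eq (D.rvsStair_itemTerm_vertex hp h t J).symm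
    · by_cases h : k.val < (J i t).val <;> simp [Data.zOf, vertex, h]

/-- A feasible point above a binary `z` whose remaining components are largest is extreme. -/
theorem Data.pointOf_mem_extremePoints (D : Data n T M) (hp : ∀ i, StrictMono (D.p i))
    (hs : ∀ i t, Supermodular (D.periodGrid i t))
    (hsc : ∀ i j, i ≠ j → D.Substitutable i j ∨ D.Complementary i j)
    {R : Option (BusinessRules n T)} {J : D.Levels} (hJ : D.planOf J ∈ D.feasible R) :
    D.pointOf J ∈ (D.lpRegion R).extremePoints ℝ := by
  have hmip : D.pointOf J ∈ D.mipRegion R :=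
    (D.mem_mipRegion_iff hp hs hsc R _).2 ⟨J, rfl, rfl, hJ, le_rfl, le_rfl⟩
  refine mem_extremePoints_iff_left.2 ⟨hmip.1, fun y hy y' hy' ⟨a, b, ha, hb, hab, hseg⟩ => ?_⟩
  -- The values 0 and 1 are extreme in `[0, 1]`, so both endpoints of the segment share the binary
  -- `z`.
  have hz : ∀ i t k, y.2.1 i t k = D.zOf J i t k ∧ y'.2.1 i t k = D.zOf J i t k := by
    intro i t k
    have h : a * y.2.1 i t k + b * y'.2.1 i t k = D.zOf J i t k :=
      congrArg (fun v : D.Var => v.2.1 i t k) hseg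
    have h1 := (hy.1 i t).2.1 k
    have h2 := (hy'.1 i t).2.1 k
    change 0 ≤ y.2.1 i t k ∧ y.2.1 i t k ≤ 1 at h1
    change 0 ≤ y'.2.1 i t k ∧ y'.2.1 i t k ≤ 1 at h2
    rcases hmip.2 i t k with h0 | h0 <;> change D.zOf J i t k = _ at h0 <;> rw [h0] at h ⊢
    · constructor <;> nlinarith [h1.1, h2.1]
    · constructor <;> nlinarith [h1.2, h2.2]
  have hyz : y.2.1 = D.zOf J := by
    funext i t k
    exact (hz i t k).1
  have hyz' : y'.2.1 = D.zOf J := by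
    funext i t k
    exact (hz i t k).2
  -- A relaxed point over this `z` is a MIP point, so its prices are determined and its `μ`, `ν` lie
  -- below the profit contributions.
  have hJy : ∀ v ∈ D.lpRegion R, v.2.1 = D.zOf J → v.1 = D.planOf J ∧
      v.2.2.1 ≤ (D.pointOf J).2.2.1 ∧ v.2.2.2 ≤ (D.pointOf J).2.2.2 := by
    intro v hv hvz
    obtain ⟨J', h1, h2, -, h3, h4⟩ := (D.mem_mipRegion_iff hp hs hsc R v).1
      ⟨hv, fun i t k => by rw [hvz]; exact hmip.2 i t k⟩
    obtain rfl : J' = J := funext fun i => funext fun t =>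
      vertex_injective _ (congrFun (congrFun (h2.symm.trans hvz) i) t)
    exact ⟨h1, h3, h4⟩
  obtain ⟨e1, e2, e3⟩ := hJy y hy hyz
  obtain ⟨-, e2', e3'⟩ := hJy y' hy' hyz'
  -- An average with positive weights of two numbers below `w` reaches `w` only if both equal it.
  have hsq : ∀ {u v w : ℝ}, u ≤ w → v ≤ w → a * u + b * v = w → u = w := by
    intro u v w h1 h2 h3
    have h4 := mul_nonneg hb.le (sub_nonneg.2 h2)
    have h5 : a * (w - u) + b * (w - v) = 0 := by linear_combination w * hab - h3
    by_contra h6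
    linarith [mul_pos ha (sub_pos.2 (lt_of_le_of_ne h1 h6))]
  refine Prod.ext e1 (Prod.ext hyz (Prod.ext ?_ ?_))
  · funext i t
    exact hsq (e2 i t) (e2' i t) (congrArg (fun v : D.Var => v.2.2.1 i t) hseg)
  · funext i j t
    exact hsq (e3 i j t) (e3' i j t) (congrArg (fun v : D.Var => v.2.2.2 i j t) hseg)

/-! ## The relaxation for substitutable items -/

/-- The levels of `z` at the threshold `s`. -/
noncomputable def Data.levelsAt (D : Data n T M) (z : D.ZVar) (s : ℝ) : D.Levels :=
  fun i t => level s (z i t)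

theorem Data.level_lagZ (D : Data n T M) (z : D.ZVar) {s : ℝ} (hs : 0 < s) (hs1 : s ≤ 1)
    (i : Fin n) (t : Fin T) (k : ℕ) :
    level s (D.lagZ z i t k) = D.lagLevel (D.levelsAt z s) i t k := by
  unfold Data.lagZ Data.lagLevel
  split_ifs with h
  · rfl
  · exact level_vertex hs hs1 _

/-- A point of the product of the unary simplices is a convex combination of comonotone
vertices. -/
theorem Data.exists_levels_decomposition (D : Data n T M) (z : D.ZVar)
    (hz : ∀ i t, z i t ∈ unarySimplex (D.d i)) :
    ∃ (S : Finset ℝ) (w : ℝ → ℝ), (∀ s ∈ S, 0 < s ∧ s ≤ 1) ∧ (∀ s ∈ S, 0 ≤ w s) ∧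
      ∑ s ∈ S, w s = 1 ∧
      ∀ i t, ∑ s ∈ S, w s • vertex (D.d i) (D.levelsAt z s i t) = z i t := by
  classical
  let vals : Finset ℝ := insert 1 (Finset.univ.image
    fun q : Σ i : Fin n, Fin T × Fin (D.d i) => z q.1 q.2.1 q.2.2)
  let S := vals.filter fun s => 0 < s
  have hS : ∀ s ∈ S, 0 < s ∧ s ≤ 1 := by
    intro s hs
    obtain ⟨hs, h0⟩ := Finset.mem_filter.1 hs
    refine ⟨h0, ?_⟩
    rcases Finset.mem_insert.1 hs with rfl | hs
    · exact le_rfl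
    · obtain ⟨q, -, rfl⟩ := Finset.mem_image.1 hs
      exact ((hz _ _).1 _).2
  obtain ⟨w, hw0, hw, -⟩ := exists_threshold_weights S fun s hs => (hS s hs).1
  refine ⟨S, w, hS, hw0, ?_, fun i t => funext fun k => ?_⟩
  · refine Eq.trans (Finset.sum_congr rfl fun s hs => ?_)
      (hw 1 (Finset.mem_filter.2 ⟨Finset.mem_insert_self _ _, one_pos⟩))
    rw [if_pos (hS s hs).2, mul_one]
  · simp only [Finset.sum_apply, Pi.smul_apply, smul_eq_mul, Data.levelsAt,
      vertex_level _ (hz i t).2]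
    rcases ((hz i t).1 k).1.eq_or_lt with h | h
    · rw [← h]
      refine Finset.sum_eq_zero fun s hs => ?_
      rw [if_neg (not_le.2 (hS s hs).1), mul_zero]
    · refine hw _ (Finset.mem_filter.2 ⟨Finset.mem_insert_of_mem ?_, h⟩)
      exact Finset.mem_image.2 ⟨⟨i, t, k⟩, Finset.mem_univ _, rfl⟩

/-- The threshold decomposition of `z` uses the same weights in all blocks, so the averaged profit
contributions dominate `μ` and `ν` simultaneously. -/
theorem Data.lpRegion_eq_convexHull (D : Data n T M) (hp : ∀ i, StrictMono (D.p i))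
    (hs : ∀ i t, Supermodular (D.periodGrid i t))
    (hsub : ∀ i j, i ≠ j → D.Substitutable i j) :
    D.lpRegion none = convexHull ℝ (D.mipRegion none) := by
  refine Set.Subset.antisymm ?_
    (convexHull_min (fun y hy => hy.1) (D.isPolyhedron_lpRegion none).convex)
  rintro ⟨x, z, μ, ν⟩ ⟨hxz, -, hμ, hν, -⟩
  obtain ⟨S, w, hS, hw0, hw1, hz⟩ := D.exists_levels_decomposition z fun i t => (hxz i t).2
  let J := D.levelsAt z
  let μ' : Fin n → Fin T → ℝ := ∑ s ∈ S, w s • D.periodProfit (J s)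
  let ν' : ∀ i : Fin n, {j : Fin n // j ≠ i} → Fin T → ℝ :=
    ∑ s ∈ S, w s • fun i (j : {j : Fin n // j ≠ i}) t => D.itemProfit (J s) i j t
  have hμ' : μ ≤ μ' := by
    intro i t
    refine (hμ i t).trans ((stairMin_le_sum_levels (d := fun _ : Fin (M + 1) => D.d i) _ S w hw1
      fun k => ?_).trans_eq ?_)
    · unfold Data.lagZ
      split_ifs with h
      · exact hz i _
      -- A block before the first period is a fixed vertex, unchanged by rounding at any threshold
      -- in `(0, 1]`.
      · rw [Finset.sum_congr rfl fun s hs => by rw [level_vertex (hS s hs).1 (hS s hs).2],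
          ← Finset.sum_smul, hw1, one_smul]
    · simp only [μ', Finset.sum_apply, Pi.smul_apply, smul_eq_mul, D.periodTerm_vertex]
      refine Finset.sum_congr rfl fun s hs => ?_
      simp only [D.level_lagZ z (hS s hs).1 (hS s hs).2]
      rfl
  have hν' : ν ≤ ν' := by
    intro i j t
    refine (hν i t j (hsub i j j.2.symm)).trans ((stairMin_le_sum_levels
      (d := fun a => D.d (![i, j.1] a)) _ S w hw1 fun a => hz _ t).trans_eq ?_)
    simp only [ν', Finset.sum_apply, Pi.smul_apply, smul_eq_mul, D.itemTerm_vertex]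
    rfl
  -- The slack is subtracted equally from every vertex point: since `μ` and `ν` are bounded only
  -- from above, this keeps feasibility, and the average becomes exactly the given point.
  let Y : ℝ → D.Var := fun s => D.pointOf (J s) + (0, 0, μ - μ', ν - ν')
  have hY : ∀ s, Y s ∈ D.mipRegion none := fun s =>
    (D.mem_mipRegion_iff hp hs (fun i j h => .inl (hsub i j h)) none _).2
      -- Absence of business rules is used here: the plan rounded at each threshold is feasible
      -- automatically.
      ⟨J s, add_zero _, add_zero _, ⟨fun i t => Set.mem_range_self _, fun B hB => by simp at hB⟩,
        add_le_of_nonpos_right (sub_nonpos.2 hμ'), add_le_of_nonpos_right (sub_nonpos.2 hν')⟩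
  have hsum : ∑ s ∈ S, w s • Y s = (x, z, μ, ν) := by
    simp only [Y, smul_add, Finset.sum_add_distrib, ← Finset.sum_smul, hw1, one_smul]
    refine Prod.ext ?_ (Prod.ext ?_ (Prod.ext ?_ ?_))
    · funext i t
      have haff : IsAffineFn (D.liftFn i id) := isAffineFn_affineLift (E := Fin (D.d i) → ℝ) _
        (z := id) fun k => ⟨LinearMap.proj k, 0, fun _ => (add_zero _).symm⟩
      simp only [Prod.fst_add, Prod.fst_sum, Prod.smul_fst, add_zero, Finset.sum_apply,
        Pi.smul_apply, smul_eq_mul]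
      rw [(hxz i t).1, ← hz i t, haff.map_sum S w hw1]
      simp only [D.liftFn_vertex]
      rfl
    · funext i t
      simp only [Prod.snd_add, Prod.fst_add, Prod.snd_sum, Prod.fst_sum, Prod.smul_snd,
        Prod.smul_fst, add_zero, Finset.sum_apply, Pi.smul_apply]
      exact hz i t
    · simp only [Prod.snd_add, Prod.fst_add, Prod.snd_sum, Prod.fst_sum, Prod.smul_snd,
        Prod.smul_fst]
      exact add_sub_cancel μ' μ
    · simp only [Prod.snd_add, Prod.snd_sum, Prod.smul_snd]
      exact add_sub_cancel ν' ν
  rw [← hsum]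
  exact (convex_convexHull ℝ _).sum_mem hw0 hw1 fun s _ => subset_convexHull ℝ _ (hY s)

/-! ## Exactness of the formulation -/

theorem Data.image_mipRegion (D : Data n T M) (hp : ∀ i, StrictMono (D.p i))
    (hs : ∀ i t, Supermodular (D.periodGrid i t))
    (hsc : ∀ i j, i ≠ j → D.Substitutable i j ∨ D.Complementary i j)
    (R : Option (BusinessRules n T)) : Prod.fst '' D.mipRegion R = D.feasible R := by
  ext x
  constructor
  · rintro ⟨y, hy, rfl⟩
    obtain ⟨J, h1, -, h2, -⟩ := (D.mem_mipRegion_iff hp hs hsc R y).1 hy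
    rwa [h1]
  · intro hx
    obtain ⟨J, rfl⟩ := D.exists_levels hx
    exact ⟨D.pointOf J, (D.mem_mipRegion_iff hp hs hsc R _).2 ⟨J, rfl, rfl, hx, le_rfl, le_rfl⟩,
      rfl⟩

theorem Data.objective_le_profit (D : Data n T M) (hp : ∀ i, StrictMono (D.p i))
    (hs : ∀ i t, Supermodular (D.periodGrid i t))
    (hsc : ∀ i j, i ≠ j → D.Substitutable i j ∨ D.Complementary i j)
    {R : Option (BusinessRules n T)} {y : D.Var} (hy : y ∈ D.mipRegion R) :
    D.objective y ≤ D.profit y.1 := by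
  obtain ⟨J, h1, -, -, h3, h4⟩ := (D.mem_mipRegion_iff hp hs hsc R y).1 hy
  rw [h1, D.profit_planOf]
  exact D.objective_mono h3 h4

theorem Data.isGreatest_objective_fiber (D : Data n T M) (hp : ∀ i, StrictMono (D.p i))
    (hs : ∀ i t, Supermodular (D.periodGrid i t))
    (hsc : ∀ i j, i ≠ j → D.Substitutable i j ∨ D.Complementary i j)
    {R : Option (BusinessRules n T)} {x : Plan n T} (hx : x ∈ D.feasible R) :
    IsGreatest (D.objective '' {y | y ∈ D.mipRegion R ∧ y.1 = x}) (D.profit x) := by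
  obtain ⟨J, rfl⟩ := D.exists_levels hx
  refine ⟨⟨D.pointOf J, ⟨(D.mem_mipRegion_iff hp hs hsc R _).2
    ⟨J, rfl, rfl, hx, le_rfl, le_rfl⟩, rfl⟩, (D.profit_planOf J).symm⟩, ?_⟩
  rintro _ ⟨y, ⟨hy, hyx⟩, rfl⟩
  rw [← hyx]
  exact D.objective_le_profit hp hs hsc hy

theorem Data.exists_isGreatest_profit (D : Data n T M) (R : Option (BusinessRules n T)) :
    ∃ v, IsGreatest (D.profit '' D.feasible R) v :=
  ((D.feasible_finite R).image _).isCompact.exists_isGreatest ((D.feasible_nonempty R).image _)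

theorem Data.isGreatest_objective (D : Data n T M) (hp : ∀ i, StrictMono (D.p i))
    (hs : ∀ i t, Supermodular (D.periodGrid i t))
    (hsc : ∀ i j, i ≠ j → D.Substitutable i j ∨ D.Complementary i j)
    {R : Option (BusinessRules n T)} {v : ℝ} (hv : IsGreatest (D.profit '' D.feasible R) v) :
    IsGreatest (D.objective '' D.mipRegion R) v := by
  constructor
  · obtain ⟨x, hx, rfl⟩ := hv.1
    exact Set.image_mono (fun y hy => hy.1) (D.isGreatest_objective_fiber hp hs hsc hx).1
  · rintro _ ⟨y, hy, rfl⟩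
    refine (D.objective_le_profit hp hs hsc hy).trans (hv.2 (Set.mem_image_of_mem _ ?_))
    rw [← D.image_mipRegion hp hs hsc R]
    exact Set.mem_image_of_mem _ hy

end PromoPlan

theorem corollary4 {n T M : ℕ} (D : PromoPlan.Data n T M)
    -- price ladders are increasing, and no price lies below the unit cost
    (hp : ∀ i, StrictMono (D.p i))
    (hc : ∀ i t, D.c i t ≤ D.p i 0)
    -- self effects and cross-period effects are non-negative
    (hf : ∀ i t, ∀ y ∈ D.ladder i, 0 ≤ D.f i i t y)
    (hh : ∀ i t k, ∀ y ∈ D.ladder i, 0 ≤ D.h i t k y)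
    -- the self profit is non-decreasing in the own price
    (hl : ∀ i t, MonotoneOn (fun y => (y - D.c i t) * D.f i i t y) (D.ladder i))
    -- post-promotion dip
    (hdip : ∀ i t k, MonotoneOn (D.h i t k) (D.ladder i))
    -- each pair of items is substitutable or complementary
    (hsc : ∀ i j, i ≠ j → D.Substitutable i j ∨ D.Complementary i j) :
    -- the formulation is an exact mixed-integer linear formulation, with any business rules
    (∀ R : Option (PromoPlan.BusinessRules n T),
      PromoPlan.IsPolyhedron (D.lpRegion R) ∧
      IsLinearMap ℝ D.objective ∧
      Prod.fst '' D.mipRegion R = D.feasible R ∧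
      (∀ x ∈ D.feasible R,
        IsGreatest (D.objective '' {y | y ∈ D.mipRegion R ∧ y.1 = x}) (D.profit x)) ∧
      ∃ v, IsGreatest (D.profit '' D.feasible R) v ∧
        IsGreatest (D.objective '' D.mipRegion R) v) ∧
    -- for substitutable items and no business rules, the LP relaxation solves the problem
    ((∀ i j, i ≠ j → D.Substitutable i j) →
      D.lpRegion none = convexHull ℝ (D.mipRegion none) ∧
      (∃ v, IsGreatest (D.profit '' D.feasible none) v ∧
        IsGreatest (D.objective '' D.lpRegion none) v) ∧
      (∃ y ∈ (D.lpRegion none).extremePoints ℝ, IsMaxOn D.objective (D.lpRegion none) y) ∧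
      (∀ y ∈ (D.lpRegion none).extremePoints ℝ, IsMaxOn D.objective (D.lpRegion none) y →
        y.1 ∈ D.feasible none ∧ IsMaxOn D.profit (D.feasible none) y.1)) := by
  have hs := D.supermodular_periodGrid hp hc hf hh hl hdip
  refine ⟨fun R => ⟨D.isPolyhedron_lpRegion R, D.objective_isLinearMap,
    D.image_mipRegion hp hs hsc R, fun x hx => D.isGreatest_objective_fiber hp hs hsc hx, ?_⟩,
    fun hsub => ?_⟩
  · obtain ⟨v, hv⟩ := D.exists_isGreatest_profit R
    exact ⟨v, hv, D.isGreatest_objective hp hs hsc hv⟩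
  have hhull := D.lpRegion_eq_convexHull hp hs hsub
  obtain ⟨v, hv⟩ := D.exists_isGreatest_profit none
  have hmip := D.isGreatest_objective hp hs hsc hv
  -- The half-space where the objective is at most `v` is convex and contains the MIP region, hence
  -- its hull.
  have hle : ∀ y ∈ D.lpRegion none, D.objective y ≤ v := by
    intro y hy
    rw [hhull] at hy
    exact convexHull_min (fun y hy => hmip.2 (Set.mem_image_of_mem _ hy))
      (convex_halfSpace_le D.objective_isLinearMap v) hy
  obtain ⟨y₀, hy₀, hyv⟩ := hmip.1
  refine ⟨hhull, ⟨v, hv, ⟨y₀, hy₀.1, hyv⟩, Set.forall_mem_image.2 hle⟩, ?_, fun y hy hmax => ?_⟩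
  -- An optimal plan, completed by its exact profit contributions, is the optimal extreme point.
  · obtain ⟨x, hx, hxv⟩ := hv.1
    obtain ⟨J, rfl⟩ := D.exists_levels hx
    refine ⟨D.pointOf J, D.pointOf_mem_extremePoints hp hs hsc hx, fun y hy => ?_⟩
    exact (hle y hy).trans_eq (hxv.symm.trans (D.profit_planOf J))
  · rw [hhull] at hy
    -- Extreme points of a hull belong to the generating set, so `y` is binary and its price
    -- component is a genuine plan.
    have hym := extremePoints_convexHull_subset hy
    have hyf : y.1 ∈ D.feasible none := by
      rw [← D.image_mipRegion hp hs hsc none]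
      exact Set.mem_image_of_mem _ hym
    have hvy : v ≤ D.objective y := hyv.symm.le.trans (hmax hy₀.1)
    exact ⟨hyf, fun x hx => (hv.2 (Set.mem_image_of_mem _ hx)).trans
      (hvy.trans (D.objective_le_profit hp hs hsc hym))⟩
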